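/- Let $n\in\mathbb N$, let $H$ be a complex Hilbert space and let $B(H)$ be the bounded operators on $H$ with the operator norm. Write $\langle\xi\rangle=\sqrt{1+|\xi|^2}$ for $\xi\in\mathbb R^n$, with $|\cdot|$ the Euclidean norm. Let $\sigma:\mathbb R^n\times\mathbb R^n\to B(H)$ be such that $\xi\mapsto\sigma(x,\xi)$ is $[n/2]+2$ times differentiable in operator norm for every $x$. Suppose that there are a non-decreasing function $\omega:[0,\infty)\to[0,\infty)$ and constants $C_\alpha$ such that, for all multi-indices $\alpha$ with $|\alpha|\le[n/2]+2$ and all $x,x',\xi\in\mathbb R^n$, $$\|\partial_\xi^\alpha\sigma(x,\xi)\|_{B(H)}\le C_\alpha\langle\xi\rangle^{-|\alpha|},\qquad \|\partial_\xi^\alpha\sigma(x,\xi)-\partial_\xi^\alpha\sigma(x',\xi)\|_{B(H)}\le C_\alpha\langle\xi\rangle^{-|\alpha|}\,\omega(|x-x'|),$$ and that $\int_0^1\omega(t)^2\,\frac{dt}{t}<\infty$. Then the pseudo-differential operator $$T_\sigma f(x)=\frac1{(2\pi)^n}\int_{\mathbb R^n}\sigma(x,\xi)\,\widehat f(\xi)\,e^{ix\cdot\xi}\,d\xi,\qquad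 \widehat f(\xi)=\int_{\mathbb R^n}f(y)\,e^{-iy\cdot\xi}\,dy,\qquad f\in\mathcal S(\mathbb R^n;H),$$ extends to a bounded linear operator on $L_2(\mathbb R^n;H)$. -/

import Mathlib

open MeasureTheory
open scoped SchwartzMap

noncomputable section

/-- The partial derivative `∂_j f`. -/
def partialD {n : ℕ} {F : Type*} [NormedAddCommGroup F] [NormedSpace ℝ F] (j : Fin n)
    (f : EuclideanSpace ℝ (Fin n) → F) : EuclideanSpace ℝ (Fin n) → F :=
  fun ξ => lineDeriv ℝ f ξ (EuclideanSpace.single j 1)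

/-- The length `|α|` of a multi-index. -/
def multiLength {n : ℕ} (α : Fin n → ℕ) : ℕ := ∑ j, α j

/-- The partial derivative `∂^α f = ∂_1^{α_1} ⋯ ∂_n^{α_n} f`. -/
def multiD {n : ℕ} {F : Type*} [NormedAddCommGroup F] [NormedSpace ℝ F] (α : Fin n → ℕ)
    (f : EuclideanSpace ℝ (Fin n) → F) : EuclideanSpace ℝ (Fin n) → F :=
  (List.finRange n).foldr (fun j g => (partialD j)^[α j] g) f

/-- `f` is `k` times (Fréchet) differentiable; the `k`-th derivative need not be continuous. -/
def TimesDifferentiable {n : ℕ} {F : Type*} [NormedAddCommGroup F] [NormedSpace ℝ F] (k : ℕ)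
    (f : EuclideanSpace ℝ (Fin n) → F) : Prop :=
  ∀ m < k, Differentiable ℝ (iteratedFDeriv ℝ m f)

/-- `⟨ξ⟩ = √(1 + |ξ|²)`. -/
def bracket {n : ℕ} (ξ : EuclideanSpace ℝ (Fin n)) : ℝ := √(1 + ‖ξ‖ ^ 2)

/-- The Fourier transform `∫ f(y) e^{-i y·ξ} dy`. -/
def angularFourier {n : ℕ} {H : Type*} [NormedAddCommGroup H] [InnerProductSpace ℂ H]
    (f : EuclideanSpace ℝ (Fin n) → H) (ξ : EuclideanSpace ℝ (Fin n)) : H :=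
  ∫ y, Complex.exp (-(Complex.I * (inner ℝ y ξ : ℝ))) • f y

/-- `T_σ f(x) = (2π)^{-n} ∫ σ(x, ξ) f̂(ξ) e^{i x·ξ} dξ`. -/
def pseudoDiff {n : ℕ} {H : Type*} [NormedAddCommGroup H] [InnerProductSpace ℂ H]
    (σ : EuclideanSpace ℝ (Fin n) → EuclideanSpace ℝ (Fin n) → (H →L[ℂ] H))
    (f : EuclideanSpace ℝ (Fin n) → H) (x : EuclideanSpace ℝ (Fin n)) : H :=
  (((2 * Real.pi) ^ n)⁻¹ : ℝ) •
    ∫ ξ, Complex.exp (Complex.I * (inner ℝ x ξ : ℝ)) • σ x ξ (angularFourier f ξ)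

end

section

open scoped FourierTransform ContDiff ENNReal InnerProductSpace

section Plancherel

variable {V F : Type*} [NormedAddCommGroup V] [InnerProductSpace ℝ V] [FiniteDimensional ℝ V]
  [MeasurableSpace V] [BorelSpace V] [NormedAddCommGroup F] [InnerProductSpace ℂ F]
  [CompleteSpace F]

theorem continuous_fourier_of_integrable {f : V → F} (hf : Integrable f) : Continuous (𝓕 f) :=
  VectorFourier.fourierIntegral_continuous Real.continuous_fourierChar
    (by exact continuous_inner) hf

/-- On `L¹ ∩ L²` the Fourier integral agrees with the `L²` Fourier transform. -/
theorem fourier_toLp_ae_eq {f : V → F} (hf : Integrable f) (hf2 : MemLp f 2) :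
    ∀ᵐ x, (𝓕 (hf2.toLp f) : Lp F 2 (volume : Measure V)) x = 𝓕 f x := by
  refine ae_eq_of_integral_contDiff_smul_eq
    ((Lp.memLp _).locallyIntegrable (by norm_num))
    (continuous_fourier_of_integrable hf).locallyIntegrable fun g hg hgc => ?_
  have hgC : ContDiff ℝ ∞ (fun x => (g x : ℂ)) := Complex.ofRealCLM.contDiff.comp hg
  have hgCc : HasCompactSupport (fun x => (g x : ℂ)) :=
    hgc.comp_left (g := fun r : ℝ => (r : ℂ)) (by simp)
  set φ : 𝓢(V, ℂ) := hgCc.toSchwartzMap hgC with hφ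
  have h1 := congrArg (fun T : 𝓢'(V, F) => T φ)
    (Lp.fourier_toTemperedDistribution_eq (hf2.toLp f))
  simp only [TemperedDistribution.fourier_apply, Lp.toTemperedDistribution_apply] at h1
  have h2 : ∫ x, (𝓕 φ) x • (hf2.toLp f : V → F) x = ∫ x, (𝓕 φ) x • f x := by
    refine integral_congr_ae ?_
    filter_upwards [hf2.coeFn_toLp] with x hx
    rw [hx]
  have h3 : ∫ x, (𝓕 (φ : V → ℂ)) x • f x = ∫ x, φ x • 𝓕 f x := by
    have := VectorFourier.integral_fourierIntegral_smul_eq_flip (μ := volume) (ν := volume)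
      (L := innerₗ V) Real.continuous_fourierChar (by exact continuous_inner) φ.integrable hf
    rw [flip_innerₗ] at this
    exact this
  rw [h2, SchwartzMap.fourier_coe, h3] at h1
  have h4 : ∀ x, φ x = (g x : ℂ) := fun x => rfl
  simp only [h4] at h1
  simpa using h1.symm

theorem lintegral_enorm_sq_fourier {f : V → F} (hf : Integrable f) (hf2 : MemLp f 2) :
    ∫⁻ x, ‖𝓕 f x‖ₑ ^ 2 = ∫⁻ x, ‖f x‖ₑ ^ 2 := by
  have h : eLpNorm (𝓕 f) 2 volume = eLpNorm f 2 volume := by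
    rw [← eLpNorm_congr_ae (fourier_toLp_ae_eq hf hf2), ← Lp.enorm_def, ← ofReal_norm,
      Lp.norm_fourier_eq, ofReal_norm, Lp.enorm_def, eLpNorm_congr_ae hf2.coeFn_toLp]
  have h1 := eLpNorm_nnreal_pow_eq_lintegral (p := 2) (f := 𝓕 f) (μ := volume) two_ne_zero
  have h2 := eLpNorm_nnreal_pow_eq_lintegral (p := 2) (f := f) (μ := volume) two_ne_zero
  have e : ((2 : NNReal) : ℝ≥0∞) = 2 := rfl
  rw [e, h, ← e, h2] at h1
  simpa using h1.symm

end Plancherel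

section LineDerivatives

variable {n : ℕ} {F : Type*} [NormedAddCommGroup F] [NormedSpace ℝ F]

theorem iterate_partialD_line (i : Fin n) (k : ℕ) (f : EuclideanSpace ℝ (Fin n) → F)
    (ξ : EuclideanSpace ℝ (Fin n)) (s : ℝ) :
    (partialD i)^[k] f (ξ + s • EuclideanSpace.single i 1) =
      iteratedDeriv k (fun t : ℝ => f (ξ + t • EuclideanSpace.single i 1)) s := by
  induction k generalizing s with
  | zero => simp
  | succ k ih =>
    rw [Function.iterate_succ_apply', iteratedDeriv_succ, partialD, lineDeriv]
    simp only [add_assoc, ← add_smul, ih]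
    rw [deriv_comp_const_add (f := iteratedDeriv k _), add_zero]

theorem iterate_partialD_eq_iteratedDeriv (i : Fin n) (k : ℕ)
    (f : EuclideanSpace ℝ (Fin n) → F) (ξ : EuclideanSpace ℝ (Fin n)) :
    (partialD i)^[k] f ξ =
      iteratedDeriv k (fun t : ℝ => f (ξ + t • EuclideanSpace.single i 1)) 0 := by
  simpa using iterate_partialD_line i k f ξ 0

theorem contDiff_line {f : EuclideanSpace ℝ (Fin n) → F} {k : ℕ} (hf : ContDiff ℝ k f)
    (ξ v : EuclideanSpace ℝ (Fin n)) : ContDiff ℝ k (fun t : ℝ => f (ξ + t • v)) :=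
  hf.comp (by fun_prop)

theorem multiLength_single (i : Fin n) (k : ℕ) : multiLength (Pi.single i k) = k := by
  simp [multiLength]

theorem foldr_iterate_single {β : Type*} (D : Fin n → β → β) (i : Fin n) (k : ℕ) (f : β)
    (l : List (Fin n)) (hl : l.Nodup) :
    l.foldr (fun j g => (D j)^[(Pi.single i k : Fin n → ℕ) j] g) f =
      if i ∈ l then (D i)^[k] f else f := by
  induction l with
  | nil => simp
  | cons a l ih =>
    rw [List.nodup_cons] at hl
    rw [List.foldr_cons, ih hl.2]
    by_cases h : a = i
    · subst h
      simp [hl.1]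
    · have h' : i ≠ a := fun e => h e.symm
      simp [h, h']

theorem multiD_single (i : Fin n) (k : ℕ) (f : EuclideanSpace ℝ (Fin n) → F) :
    multiD (Pi.single i k) f = (partialD i)^[k] f := by
  rw [multiD, foldr_iterate_single partialD i k f _ (List.nodup_finRange n)]
  simp

theorem multiD_zero (f : EuclideanSpace ℝ (Fin n) → F) : multiD 0 f = f := by
  simp only [multiD, Pi.zero_apply, Function.iterate_zero, id]
  induction List.finRange n with
  | nil => rfl
  | cons a l ih => simpa using ih

theorem TimesDifferentiable.contDiff {k : ℕ} {f : EuclideanSpace ℝ (Fin n) → F}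
    (hf : TimesDifferentiable (k + 1) f) : ContDiff ℝ k f :=
  contDiff_nat_iff_continuous_differentiable.2
    ⟨fun m hm => (hf m (by omega)).continuous, fun m hm => hf m (by omega)⟩

theorem partialD_eq_fderiv {f : EuclideanSpace ℝ (Fin n) → F} (hf : Differentiable ℝ f)
    (i : Fin n) : partialD i f = fun ξ => fderiv ℝ f ξ (EuclideanSpace.single i 1) :=
  funext fun ξ => (hf ξ).lineDeriv_eq_fderiv

theorem iterate_partialD_contDiff {f : EuclideanSpace ℝ (Fin n) → F} (i : Fin n) (k m : ℕ)
    (hf : ContDiff ℝ (k + m : ℕ) f) : ContDiff ℝ m ((partialD i)^[k] f) := by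
  induction k generalizing f with
  | zero => simpa using hf
  | succ k ih =>
    rw [Function.iterate_succ_apply]
    refine ih ?_
    rw [partialD_eq_fderiv (hf.differentiable (by simp))]
    exact (hf.fderiv_right (by norm_cast; omega)).clm_apply contDiff_const

theorem iterate_partialD_hasCompactSupport {f : EuclideanSpace ℝ (Fin n) → F} (i : Fin n) (k : ℕ)
    (hf : ContDiff ℝ k f) (hc : HasCompactSupport f) :
    HasCompactSupport ((partialD i)^[k] f) := by
  induction k generalizing f with
  | zero => simpa using hc
  | succ k ih =>
    rw [Function.iterate_succ_apply]
    refine ih ?_ ?_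
    · simpa using iterate_partialD_contDiff i 1 k (f := f) (by rwa [add_comm])
    · rw [partialD_eq_fderiv (hf.differentiable (by simp))]
      exact hc.fderiv_apply ℝ _

theorem support_iterate_partialD_subset (f : EuclideanSpace ℝ (Fin n) → F) (i : Fin n) (k : ℕ) :
    Function.support ((partialD i)^[k] f) ⊆ tsupport f := by
  intro ξ hξ
  by_contra hξ'
  apply hξ
  have h0 : ∀ᶠ η in nhds ξ, f η = 0 := by
    rw [notMem_tsupport_iff_eventuallyEq] at hξ'
    exact hξ'
  rw [iterate_partialD_eq_iteratedDeriv]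
  have h1 : (fun t : ℝ => f (ξ + t • EuclideanSpace.single i 1)) =ᶠ[nhds 0] fun _ => 0 := by
    have : Filter.Tendsto (fun t : ℝ => ξ + t • EuclideanSpace.single i (1 : ℝ)) (nhds 0)
        (nhds ξ) := by
      have hc : Continuous (fun t : ℝ => ξ + t • EuclideanSpace.single i (1 : ℝ)) := by fun_prop
      simpa using hc.tendsto 0
    exact this.eventually h0
  rw [h1.iteratedDeriv_eq]
  simp

theorem iterate_partialD_sub {f g : EuclideanSpace ℝ (Fin n) → F} {k : ℕ} (hf : ContDiff ℝ k f)
    (hg : ContDiff ℝ k g) (i : Fin n) (ξ : EuclideanSpace ℝ (Fin n)) :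
    (partialD i)^[k] (fun η => f η - g η) ξ = (partialD i)^[k] f ξ - (partialD i)^[k] g ξ := by
  simp only [iterate_partialD_eq_iteratedDeriv]
  exact iteratedDeriv_fun_sub (contDiff_line hf _ _).contDiffAt (contDiff_line hg _ _).contDiffAt

theorem iterate_partialD_comp_smul {f : EuclideanSpace ℝ (Fin n) → F} {k : ℕ}
    (hf : ContDiff ℝ k f) (c : ℝ) (i : Fin n) (ξ : EuclideanSpace ℝ (Fin n)) :
    (partialD i)^[k] (fun η => f (c • η)) ξ = c ^ k • (partialD i)^[k] f (c • ξ) := by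
  simp only [iterate_partialD_eq_iteratedDeriv, smul_add, smul_smul]
  have h := congrFun (iteratedDeriv_comp_const_smul (contDiff_line hf (c • ξ)
    (EuclideanSpace.single i (1 : ℝ))) c) 0
  simpa using h

theorem norm_iterate_partialD_smul_le {G : Type*} [NormedAddCommGroup G] [NormedSpace ℝ G]
    {φ : EuclideanSpace ℝ (Fin n) → ℝ}
    {f : EuclideanSpace ℝ (Fin n) → G} {k : ℕ} (hφ : ContDiff ℝ k φ) (hf : ContDiff ℝ k f)
    (i : Fin n) (ξ : EuclideanSpace ℝ (Fin n)) :
    ‖(partialD i)^[k] (fun η => φ η • f η) ξ‖ ≤ ∑ l ∈ Finset.range (k + 1),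
      (k.choose l : ℝ) * ‖(partialD i)^[l] φ ξ‖ * ‖(partialD i)^[k - l] f ξ‖ := by
  simp only [iterate_partialD_eq_iteratedDeriv, ← norm_iteratedFDeriv_eq_norm_iteratedDeriv]
  exact norm_iteratedFDeriv_smul_le (contDiff_line hφ _ _) (contDiff_line hf _ _) 0 le_rfl

end LineDerivatives

theorem fourier_iterate_partialD {n : ℕ} {F : Type*} [NormedAddCommGroup F] [NormedSpace ℂ F]
    [CompleteSpace F] {f : EuclideanSpace ℝ (Fin n) → F} (i : Fin n) (k : ℕ)
    (hf : ContDiff ℝ k f) (hc : HasCompactSupport f) (z : EuclideanSpace ℝ (Fin n)) :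
    𝓕 ((partialD i)^[k] f) z = (2 * Real.pi * Complex.I * z i) ^ k • 𝓕 f z := by
  induction k generalizing f with
  | zero => simp
  | succ k ih =>
    have hd : Differentiable ℝ f := hf.differentiable (by simp)
    have h1 : ContDiff ℝ k (partialD i f) := by
      simpa using iterate_partialD_contDiff i 1 k (f := f) (by rwa [add_comm])
    have h2 : HasCompactSupport (partialD i f) := by
      rw [partialD_eq_fderiv hd]
      exact hc.fderiv_apply ℝ _
    rw [Function.iterate_succ_apply, ih h1 h2, pow_succ, mul_smul]
    congr 1
    have hfi : Integrable (fderiv ℝ f) :=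
      (hf.continuous_fderiv (by simp)).integrable_of_hasCompactSupport (hc.fderiv ℝ)
    have h3 := Real.fourier_fderiv (hd.continuous.integrable_of_hasCompactSupport hc) hd hfi
    rw [partialD_eq_fderiv hd, ← Real.fourier_continuousLinearMap_apply hfi, h3]
    have h4 : ((innerSL ℝ) z) (EuclideanSpace.single i (1 : ℝ)) = z i := by
      rw [innerSL_apply_apply, EuclideanSpace.inner_single_right]
      simp
    simp only [VectorFourier.fourierSMulRight_apply, neg_apply, h4, neg_smul,
      smul_neg, neg_neg]
    rw [← Complex.coe_smul, smul_smul]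

theorem sq_lintegral_mul_le {α : Type*} [MeasurableSpace α] (μ : Measure α) {f g : α → ℝ≥0∞}
    (hf : AEMeasurable f μ) (hg : AEMeasurable g μ) :
    (∫⁻ a, f a * g a ∂μ) ^ 2 ≤ (∫⁻ a, f a ^ 2 ∂μ) * ∫⁻ a, g a ^ 2 ∂μ := by
  have h := ENNReal.lintegral_mul_le_Lp_mul_Lq μ Real.HolderConjugate.two_two hf hg
  have h2 := pow_le_pow_left' h 2
  simp only [Pi.mul_apply, mul_pow, ← ENNReal.rpow_natCast, ← ENNReal.rpow_mul] at h2 ⊢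
  simpa using h2

theorem lintegral_comp_smul_pos {V : Type*} [NormedAddCommGroup V] [NormedSpace ℝ V]
    [FiniteDimensional ℝ V] [MeasurableSpace V] [BorelSpace V] (μ : Measure V) [μ.IsAddHaarMeasure]
    (f : V → ℝ≥0∞) {R : ℝ} (hR : 0 < R) :
    ∫⁻ x, f (R • x) ∂μ = ENNReal.ofReal (R ^ Module.finrank ℝ V)⁻¹ * ∫⁻ x, f x ∂μ := by
  have h := lintegral_map_equiv (μ := μ) f (Homeomorph.smulOfNeZero R hR.ne').toMeasurableEquiv
  have h' : (∫⁻ a, f ((Homeomorph.smulOfNeZero R hR.ne').toMeasurableEquiv a) ∂μ)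
      = ∫⁻ x, f (R • x) ∂μ := rfl
  rw [← h', ← h]
  have h3 : Measure.map (Homeomorph.smulOfNeZero R hR.ne').toMeasurableEquiv μ =
      ENNReal.ofReal |(R ^ Module.finrank ℝ V)⁻¹| • μ := Measure.map_addHaar_smul μ hR.ne'
  rw [h3, lintegral_smul_measure, abs_of_pos (by positivity), smul_eq_mul]

section Kernel

variable {n : ℕ}

/-- The weight `1 + ∑ |z_i| ^ (2 * N)`. -/
noncomputable def kernelWeight (N : ℕ) (z : EuclideanSpace ℝ (Fin n)) : ℝ≥0∞ :=
  1 + ∑ i, ‖z i‖ₑ ^ (2 * N)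

theorem measurable_kernelWeight (N : ℕ) :
    Measurable (kernelWeight N : EuclideanSpace ℝ (Fin n) → ℝ≥0∞) := by
  unfold kernelWeight
  fun_prop

theorem kernelWeight_ne_zero (N : ℕ) (z : EuclideanSpace ℝ (Fin n)) : kernelWeight N z ≠ 0 := by
  simp [kernelWeight]

theorem kernelWeight_ne_top (N : ℕ) (z : EuclideanSpace ℝ (Fin n)) : kernelWeight N z ≠ ⊤ := by
  simp [kernelWeight, ENNReal.sum_eq_top]

theorem kernelWeight_eq_ofReal (N : ℕ) (z : EuclideanSpace ℝ (Fin n)) :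
    kernelWeight N z = ENNReal.ofReal (1 + ∑ i, |z i| ^ (2 * N)) := by
  rw [ENNReal.ofReal_add zero_le_one (by positivity),
    ENNReal.ofReal_sum_of_nonneg (fun i _ => by positivity)]
  simp [kernelWeight, ENNReal.ofReal_pow, Real.enorm_eq_ofReal_abs]

theorem norm_pow_le_sum {N : ℕ} (hN : N ≠ 0) (z : EuclideanSpace ℝ (Fin n)) :
    ‖z‖ ^ (2 * N) ≤ (n + 1 : ℝ) ^ N * ∑ i, |z i| ^ (2 * N) := by
  obtain ⟨M, rfl⟩ := Nat.exists_eq_succ_of_ne_zero hN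
  rw [pow_mul, EuclideanSpace.norm_sq_eq]
  have h := pow_sum_div_card_le_sum_pow (s := (Finset.univ : Finset (Fin n)))
    (f := fun i => ‖z i‖ ^ 2) (fun i _ => by positivity) M
  rcases Nat.eq_zero_or_pos n with rfl | hn
  · simp
  have hn' : (0 : ℝ) < n := by exact_mod_cast hn
  rw [div_le_iff₀ (by simpa using pow_pos hn' M)] at h
  simp only [Finset.card_univ, Fintype.card_fin, ← pow_mul, Real.norm_eq_abs] at h ⊢
  refine h.trans ?_
  rw [mul_comm]
  gcongr
  calc (n : ℝ) ^ M ≤ (n + 1 : ℝ) ^ M := by gcongr; linarith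
    _ ≤ (n + 1 : ℝ) ^ (M + 1) := pow_le_pow_right₀ (by linarith) (by omega)

theorem lintegral_inv_kernelWeight_lt_top {N : ℕ} (hN : n < 2 * N) :
    ∫⁻ z : EuclideanSpace ℝ (Fin n), (kernelWeight N z)⁻¹ < ⊤ := by
  have hN0 : N ≠ 0 := by omega
  have h := finite_integral_one_add_norm (μ := (volume : Measure (EuclideanSpace ℝ (Fin n))))
    (r := (2 * N : ℕ)) (by simpa using by exact_mod_cast hN)
  set K : ℝ := 2 ^ (2 * N) * (n + 1 : ℝ) ^ N with hK
  have hK1 : 0 < K := by positivity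
  refine lt_of_le_of_lt (lintegral_mono (g := fun z => ENNReal.ofReal K *
    ENNReal.ofReal ((1 + ‖z‖) ^ (-((2 * N : ℕ) : ℝ)))) fun z => ?_) ?_
  · beta_reduce
    rw [kernelWeight_eq_ofReal, ← ENNReal.ofReal_inv_of_pos (by positivity),
      ← ENNReal.ofReal_mul hK1.le]
    refine ENNReal.ofReal_le_ofReal ?_
    rw [Real.rpow_neg (by positivity), Real.rpow_natCast, ← div_eq_mul_inv, inv_eq_one_div,
      div_le_div_iff₀ (by positivity) (by positivity), one_mul]
    have h1 := add_pow_le zero_le_one (norm_nonneg z) (2 * N)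
    have h2 := norm_pow_le_sum hN0 z
    have h3 : (1 : ℝ) ≤ (n + 1 : ℝ) ^ N := one_le_pow₀ (by linarith [n.cast_nonneg (α := ℝ)])
    calc (1 + ‖z‖) ^ (2 * N) ≤ 2 ^ (2 * N - 1) * (1 ^ (2 * N) + ‖z‖ ^ (2 * N)) := h1
      _ ≤ 2 ^ (2 * N) * ((n + 1 : ℝ) ^ N + (n + 1 : ℝ) ^ N * ∑ i, |z i| ^ (2 * N)) := by
          gcongr
          · norm_num
          · omega
          · simpa using h3
      _ = K * (1 + ∑ i, |z i| ^ (2 * N)) := by rw [hK]; ring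
  · rw [lintegral_const_mul _ (by fun_prop)]
    exact ENNReal.mul_lt_top ENNReal.ofReal_lt_top h

theorem lintegral_enorm_sq_le_of_support {F : Type*} [NormedAddCommGroup F]
    {S : Set (EuclideanSpace ℝ (Fin n))} (hS : MeasurableSet S)
    {m : EuclideanSpace ℝ (Fin n) → F} (hm : Function.support m ⊆ S) {A : ℝ}
    (hA : ∀ ξ, ‖m ξ‖ ≤ A) : ∫⁻ ξ, ‖m ξ‖ₑ ^ 2 ≤ ENNReal.ofReal A ^ 2 * volume S := by
  calc ∫⁻ ξ, ‖m ξ‖ₑ ^ 2 ≤ ∫⁻ ξ, S.indicator (fun _ => ENNReal.ofReal A ^ 2) ξ := by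
        refine lintegral_mono fun ξ => ?_
        by_cases h : ξ ∈ S
        · rw [Set.indicator_of_mem h]
          gcongr
          rw [← ofReal_norm]
          exact ENNReal.ofReal_le_ofReal (hA ξ)
        · have : m ξ = 0 := by
            by_contra h'
            exact h (hm h')
          simp [this]
    _ = _ := by rw [lintegral_indicator_const hS]

theorem lintegral_kernelWeight_mul_fourier_le {F : Type*} [NormedAddCommGroup F]
    [InnerProductSpace ℂ F] [CompleteSpace F] {N : ℕ} {S : Set (EuclideanSpace ℝ (Fin n))}
    (hS : IsCompact S) {m : EuclideanSpace ℝ (Fin n) → F} (hm : ContDiff ℝ N m)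
    (hmS : Function.support m ⊆ S) {A R : ℝ} (hR : 0 < R)
    (hA : ∀ ξ, ‖m ξ‖ ≤ A) (hA' : ∀ i ξ, ‖(partialD i)^[N] m ξ‖ ≤ A * (R ^ N)⁻¹) :
    ∫⁻ z, kernelWeight N (R • z) * ‖𝓕 m z‖ₑ ^ 2 ≤
      (n + 1) * ENNReal.ofReal A ^ 2 * volume S := by
  have hmt : tsupport m ⊆ S := closure_minimal hmS hS.isClosed
  have hc : HasCompactSupport m := hS.of_isClosed_subset isClosed_closure hmt
  have hA0 : 0 ≤ A := (norm_nonneg _).trans (hA 0)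
  have hi : Integrable m := hm.continuous.integrable_of_hasCompactSupport hc
  have hi2 : MemLp m 2 := hm.continuous.memLp_of_hasCompactSupport hc
  have hd : ∀ i, Continuous ((partialD i)^[N] m) := fun i =>
    (iterate_partialD_contDiff i N 0 (by simpa using hm)).continuous
  have hdc : ∀ i, HasCompactSupport ((partialD i)^[N] m) := fun i =>
    iterate_partialD_hasCompactSupport i N hm hc
  have hcF : Continuous (𝓕 m) := continuous_fourier_of_integrable hi
  have key : ∀ (i : Fin n) (z : EuclideanSpace ℝ (Fin n)),
      ‖(R • z) i‖ₑ ^ (2 * N) * ‖𝓕 m z‖ₑ ^ 2 ≤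
        ENNReal.ofReal (R ^ N) ^ 2 * ‖𝓕 ((partialD i)^[N] m) z‖ₑ ^ 2 := by
    intro i z
    rw [fourier_iterate_partialD i N hm hc, mul_comm 2 N, pow_mul, ← mul_pow, ← mul_pow]
    refine pow_le_pow_left' ?_ 2
    rw [enorm_smul, ← mul_assoc]
    refine mul_le_mul_left ?_ _
    rw [← ofReal_norm, ← ofReal_norm, ← ENNReal.ofReal_pow (norm_nonneg _),
      ← ENNReal.ofReal_mul (by positivity)]
    refine ENNReal.ofReal_le_ofReal ?_
    rw [norm_pow, ← mul_pow]
    gcongr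
    simp only [PiLp.smul_apply, smul_eq_mul, norm_mul, Complex.norm_ofNat, Complex.norm_real,
      Complex.norm_I, mul_one, Real.norm_eq_abs, abs_of_pos hR, abs_of_pos Real.pi_pos]
    gcongr
    have : 1 ≤ 2 * Real.pi := by linarith [Real.pi_gt_three]
    nlinarith [abs_nonneg (z i)]
  calc ∫⁻ z, kernelWeight N (R • z) * ‖𝓕 m z‖ₑ ^ 2
      ≤ ∫⁻ z, (‖𝓕 m z‖ₑ ^ 2 +
          ∑ i, ENNReal.ofReal (R ^ N) ^ 2 * ‖𝓕 ((partialD i)^[N] m) z‖ₑ ^ 2) := by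
        refine lintegral_mono fun z => ?_
        rw [kernelWeight, add_mul, one_mul, Finset.sum_mul]
        exact add_le_add_right (Finset.sum_le_sum fun i _ => key i z) _
    _ = (∫⁻ z, ‖𝓕 m z‖ₑ ^ 2) +
          ∑ i, ENNReal.ofReal (R ^ N) ^ 2 * ∫⁻ z, ‖𝓕 ((partialD i)^[N] m) z‖ₑ ^ 2 := by
        have hmeas : ∀ i, Measurable fun z => ‖𝓕 ((partialD i)^[N] m) z‖ₑ ^ 2 := fun i =>
          ((continuous_fourier_of_integrable
            ((hd i).integrable_of_hasCompactSupport (hdc i))).enorm.measurable).pow_const 2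
        rw [lintegral_add_left (hcF.enorm.measurable.pow_const 2),
          lintegral_finsetSum _ (fun i _ => (hmeas i).const_mul _)]
        congr 1
        refine Finset.sum_congr rfl fun i _ => ?_
        rw [lintegral_const_mul _ (hmeas i)]
    _ ≤ ENNReal.ofReal A ^ 2 * volume S +
          ∑ _i : Fin n, ENNReal.ofReal A ^ 2 * volume S := by
        rw [lintegral_enorm_sq_fourier hi hi2]
        refine add_le_add (lintegral_enorm_sq_le_of_support hS.measurableSet hmS hA)
          (Finset.sum_le_sum fun i _ => ?_)
        rw [lintegral_enorm_sq_fourier ((hd i).integrable_of_hasCompactSupport (hdc i))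
          ((hd i).memLp_of_hasCompactSupport (hdc i))]
        calc _ ≤ ENNReal.ofReal (R ^ N) ^ 2 *
              (ENNReal.ofReal (A * (R ^ N)⁻¹) ^ 2 * volume S) := by
              gcongr
              exact lintegral_enorm_sq_le_of_support hS.measurableSet
                ((support_iterate_partialD_subset m i N).trans hmt) (hA' i)
          _ = _ := by
              rw [← mul_assoc, ← mul_pow, ← ENNReal.ofReal_mul (by positivity)]
              congr 4
              field_simp
    _ = _ := by
        rw [Finset.sum_const, Finset.card_univ, Fintype.card_fin, nsmul_eq_mul]
        ring

end Kernel

section Multiplier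

variable {n : ℕ} {H : Type*} [NormedAddCommGroup H] [InnerProductSpace ℂ H]

/-- The operator-valued Fourier multiplier `f ↦ 𝓕⁻¹ (b 𝓕 f)`. -/
noncomputable def multOp (b : EuclideanSpace ℝ (Fin n) → (H →L[ℂ] H))
    (f : EuclideanSpace ℝ (Fin n) → H) : EuclideanSpace ℝ (Fin n) → H :=
  𝓕⁻ (fun ξ => b ξ (𝓕 f ξ))

theorem multOp_apply (b : EuclideanSpace ℝ (Fin n) → (H →L[ℂ] H))
    (f : EuclideanSpace ℝ (Fin n) → H) (x : EuclideanSpace ℝ (Fin n)) :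
    multOp b f x = ∫ ξ, Real.fourierChar (inner ℝ ξ x) • b ξ (𝓕 f ξ) :=
  Real.fourierInv_eq _ _

variable [CompleteSpace H]

/-- The real-linear map `B ↦ B* v`. -/
noncomputable def adjointApply (v : H) : (H →L[ℂ] H) →L[ℝ] H :=
  LinearMap.mkContinuous
    { toFun := fun B => ContinuousLinearMap.adjoint B v
      map_add' := fun B B' => by simp
      map_smul' := fun r B => by
        have : (r • B) = (r : ℂ) • B := by ext; simp
        rw [this, map_smulₛₗ]
        simp } ‖v‖ fun B => by
        change ‖ContinuousLinearMap.adjoint B v‖ ≤ _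
        refine (ContinuousLinearMap.le_opNorm _ _).trans ?_
        rw [LinearIsometryEquiv.norm_map, mul_comm]

theorem adjointApply_apply (v : H) (B : H →L[ℂ] H) :
    adjointApply v B = ContinuousLinearMap.adjoint B v := rfl

theorem norm_adjointApply_le (v : H) : ‖adjointApply v‖ ≤ ‖v‖ :=
  LinearMap.mkContinuous_norm_le _ (norm_nonneg _) _

theorem norm_iterate_partialD_clm_comp_le {F G : Type*} [NormedAddCommGroup F] [NormedSpace ℝ F]
    [NormedAddCommGroup G] [NormedSpace ℝ G] (L : F →L[ℝ] G) {f : EuclideanSpace ℝ (Fin n) → F}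
    {k : ℕ} (hf : ContDiff ℝ k f) (i : Fin n) (ξ : EuclideanSpace ℝ (Fin n)) :
    ‖(partialD i)^[k] (fun η => L (f η)) ξ‖ ≤ ‖L‖ * ‖(partialD i)^[k] f ξ‖ := by
  simp only [iterate_partialD_eq_iteratedDeriv, ← norm_iteratedFDeriv_eq_norm_iteratedDeriv]
  exact L.norm_iteratedFDeriv_comp_left (contDiff_line hf _ _).contDiffAt le_rfl

theorem fourier_comp_add_right (f : EuclideanSpace ℝ (Fin n) → H)
    (x ξ : EuclideanSpace ℝ (Fin n)) :
    𝓕 (fun y => f (y + x)) ξ = Real.fourierChar (inner ℝ ξ x) • 𝓕 f ξ := by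
  have h := congrFun (VectorFourier.fourierIntegral_comp_add_right Real.fourierChar volume
    (innerₗ (EuclideanSpace ℝ (Fin n))) f x) ξ
  rw [real_inner_comm]
  exact h

/-- `⟨v, b(D) f (x)⟩` as a pairing of the kernel with `f`. -/
theorem inner_multOp_eq {b : EuclideanSpace ℝ (Fin n) → (H →L[ℂ] H)} (hb : Continuous b)
    (hbc : HasCompactSupport b) (f : 𝓢(EuclideanSpace ℝ (Fin n), H))
    (x : EuclideanSpace ℝ (Fin n)) (v : H) :
    ⟪multOp b f x, v⟫_ℂ = ∫ y, ⟪f (y + x), 𝓕 (fun ξ => adjointApply v (b ξ)) (-y)⟫_ℂ := by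
  set m : EuclideanSpace ℝ (Fin n) → H := fun ξ => adjointApply v (b ξ) with hm
  have hmc : Continuous m := (adjointApply v).continuous.comp hb
  have hms : HasCompactSupport m := hbc.comp_left (map_zero _)
  have hmi : Integrable m := hmc.integrable_of_hasCompactSupport hms
  have hFf : Continuous (𝓕 (f : EuclideanSpace ℝ (Fin n) → H)) :=
    continuous_fourier_of_integrable f.integrable
  have hInt : Integrable (fun ξ => Real.fourierChar (inner ℝ ξ x) •
      b ξ (𝓕 (f : EuclideanSpace ℝ (Fin n) → H) ξ)) := by
    refine Continuous.integrable_of_hasCompactSupport ?_ ?_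
    · have : Continuous fun ξ : EuclideanSpace ℝ (Fin n) => Real.fourierChar (inner ℝ ξ x) :=
        Real.continuous_fourierChar.comp (by fun_prop)
      exact this.smul (hb.clm_apply hFf)
    · refine hbc.mono fun ξ hξ => ?_
      intro h
      apply hξ
      simp [h]
  have hF : Integrable (fun y => f (y + x)) := f.integrable.comp_add_right x
  have h1 : ⟪v, multOp b f x⟫_ℂ = ∫ ξ, ⟪m ξ, 𝓕 (fun y => f (y + x)) ξ⟫_ℂ := by
    rw [multOp_apply, ← integral_inner hInt]
    congr 1
    ext ξ
    simp only [hm]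
    rw [fourier_comp_add_right, adjointApply_apply, ContinuousLinearMap.adjoint_inner_left]
    rw [Circle.smul_def, Circle.smul_def, map_smul]
  have h2 : ⟪multOp b f x, v⟫_ℂ = ∫ ξ, ⟪𝓕 (fun y => f (y + x)) ξ, m ξ⟫_ℂ := by
    rw [← inner_conj_symm, h1, ← integral_conj]
    simp only [inner_conj_symm]
  have h3 := VectorFourier.integral_sesq_fourierIntegral_eq_neg_flip (μ := volume) (ν := volume)
      (L := innerₗ (EuclideanSpace ℝ (Fin n))) (innerSL ℂ (E := H)) Real.continuous_fourierChar
      (by exact continuous_inner) hF hmi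
  rw [h2]
  refine Eq.trans h3 ?_
  congr 1
  ext y
  rw [← Real.fourierInv_eq_fourier_neg, flip_innerₗ]
  rfl

theorem enorm_sq_multOp_le {N : ℕ} {S : Set (EuclideanSpace ℝ (Fin n))} (hS : IsCompact S)
    {b : EuclideanSpace ℝ (Fin n) → (H →L[ℂ] H)} (hb : ContDiff ℝ N b)
    (hbS : Function.support b ⊆ S) {A R : ℝ} (hR : 0 < R)
    (hA : ∀ ξ, ‖b ξ‖ ≤ A) (hA' : ∀ i ξ, ‖(partialD i)^[N] b ξ‖ ≤ A * (R ^ N)⁻¹)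
    (f : 𝓢(EuclideanSpace ℝ (Fin n), H)) (x : EuclideanSpace ℝ (Fin n)) :
    ‖multOp b f x‖ₑ ^ 2 ≤ (n + 1) * ENNReal.ofReal A ^ 2 * volume S *
      ∫⁻ y, (kernelWeight N (R • (x - y)))⁻¹ * ‖f y‖ₑ ^ 2 := by
  have hA0 : 0 ≤ A := (norm_nonneg _).trans (hA 0)
  have hbc : HasCompactSupport b :=
    hS.of_isClosed_subset isClosed_closure (closure_minimal hbS hS.isClosed)
  set v := multOp b f x with hv
  set m : EuclideanSpace ℝ (Fin n) → H := fun ξ => adjointApply v (b ξ) with hm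
  have hmC : ContDiff ℝ N m := (adjointApply v).contDiff.comp hb
  have hmS : Function.support m ⊆ S := fun ξ hξ => hbS fun h => hξ (by simp [hm, h])
  have hmi : Integrable m := hmC.continuous.integrable_of_hasCompactSupport
    (hbc.comp_left (map_zero _))
  have hmA : ∀ ξ, ‖m ξ‖ ≤ ‖v‖ * A := fun ξ =>
    ((adjointApply v).le_opNorm _).trans
      (mul_le_mul (norm_adjointApply_le v) (hA ξ) (norm_nonneg _) (norm_nonneg _))
  have hmA' : ∀ i ξ, ‖(partialD i)^[N] m ξ‖ ≤ ‖v‖ * A * (R ^ N)⁻¹ := fun i ξ =>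
    (norm_iterate_partialD_clm_comp_le _ hb i ξ).trans (by
      rw [mul_assoc]
      exact mul_le_mul (norm_adjointApply_le v) (hA' i ξ) (norm_nonneg _) (norm_nonneg _))
  have hw := lintegral_kernelWeight_mul_fourier_le hS hmC hmS hR hmA hmA'
  have hFm : Continuous (𝓕 m) := continuous_fourier_of_integrable hmi
  set I := ∫⁻ y, (kernelWeight N (R • (x - y)))⁻¹ * ‖f y‖ₑ ^ 2 with hI
  set W : EuclideanSpace ℝ (Fin n) → ℝ≥0∞ := fun y => kernelWeight N (R • (-y)) with hW
  have hWm : Measurable W :=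
    (measurable_kernelWeight N).comp (by fun_prop)
  have hroot : ∀ w : ℝ≥0∞, w ≠ 0 → w ≠ ⊤ → (w⁻¹) ^ (1 / 2 : ℝ) * w ^ (1 / 2 : ℝ) = 1 := by
    intro w h0 ht
    rw [← ENNReal.mul_rpow_of_nonneg _ _ (by norm_num), ENNReal.inv_mul_cancel h0 ht,
      ENNReal.one_rpow]
  have hsq : ∀ w : ℝ≥0∞, (w ^ (1 / 2 : ℝ)) ^ 2 = w := by
    intro w
    rw [← ENNReal.rpow_natCast, ← ENNReal.rpow_mul]
    norm_num
  have e1 : ‖v‖ₑ ^ 2 ≤ ∫⁻ y, ((W y)⁻¹ ^ (1 / 2 : ℝ) * ‖f (y + x)‖ₑ) *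
      (W y ^ (1 / 2 : ℝ) * ‖𝓕 m (-y)‖ₑ) := by
    have h := inner_multOp_eq hb.continuous hbc f x v
    have h' : ‖v‖ₑ ^ 2 = ‖⟪v, v⟫_ℂ‖ₑ := by
      rw [inner_self_eq_norm_sq_to_K, ← ofReal_norm, ← ofReal_norm, norm_pow,
        ← ENNReal.ofReal_pow (norm_nonneg _)]
      simp
    rw [h', show ⟪v, v⟫_ℂ = ⟪multOp b f x, v⟫_ℂ from rfl, h]
    refine (enorm_integral_le_lintegral_enorm _).trans (lintegral_mono fun y => ?_)
    calc ‖⟪f (y + x), 𝓕 m (-y)⟫_ℂ‖ₑ ≤ ‖f (y + x)‖ₑ * ‖𝓕 m (-y)‖ₑ := by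
          rw [← ofReal_norm, ← ofReal_norm, ← ofReal_norm,
            ← ENNReal.ofReal_mul (norm_nonneg _)]
          exact ENNReal.ofReal_le_ofReal (norm_inner_le_norm _ _)
      _ = ((W y)⁻¹ ^ (1 / 2 : ℝ) * W y ^ (1 / 2 : ℝ)) * (‖f (y + x)‖ₑ * ‖𝓕 m (-y)‖ₑ) := by
          rw [hroot _ (kernelWeight_ne_zero _ _) (kernelWeight_ne_top _ _), one_mul]
      _ = _ := by ring
  have e2 := (pow_le_pow_left' e1 2).trans (sq_lintegral_mul_le volume
    (f := fun y => (W y)⁻¹ ^ (1 / 2 : ℝ) * ‖f (y + x)‖ₑ)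
    (g := fun y => W y ^ (1 / 2 : ℝ) * ‖𝓕 m (-y)‖ₑ)
    (((hWm.inv.pow_const _).mul
      (f.continuous.comp (continuous_add_const x)).enorm.measurable).aemeasurable)
    (((hWm.pow_const _).mul
      (hFm.comp continuous_neg).enorm.measurable).aemeasurable))
  simp only [mul_pow, hsq] at e2
  have e3 : ∫⁻ y, (W y)⁻¹ * ‖f (y + x)‖ₑ ^ 2 = I := by
    rw [hI, ← lintegral_add_right_eq_self
      (fun y => (kernelWeight N (R • (x - y)))⁻¹ * ‖f y‖ₑ ^ 2) x]
    refine lintegral_congr fun y => ?_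
    rw [hW, show x - (y + x) = -y by abel]
  have e4 : ∫⁻ y, W y * ‖𝓕 m (-y)‖ₑ ^ 2 = ∫⁻ z, kernelWeight N (R • z) * ‖𝓕 m z‖ₑ ^ 2 :=
    lintegral_neg_eq_self (fun z => kernelWeight N (R • z) * ‖𝓕 m z‖ₑ ^ 2)
  rw [e3, e4] at e2
  rcases eq_or_ne ‖v‖ₑ 0 with h0 | h0
  · simp [h0]
  have hv2 : ‖v‖ₑ ^ 2 ≠ 0 := pow_ne_zero 2 h0
  have hvt : ‖v‖ₑ ^ 2 ≠ ⊤ := ENNReal.pow_ne_top enorm_ne_top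
  rw [← ENNReal.mul_le_mul_iff_right hv2 hvt]
  calc ‖v‖ₑ ^ 2 * ‖v‖ₑ ^ 2 = (‖v‖ₑ ^ 2) ^ 2 := by ring
    _ ≤ I * ((n + 1) * ENNReal.ofReal (‖v‖ * A) ^ 2 * volume S) :=
        e2.trans (mul_le_mul_right hw _)
    _ = _ := by
        rw [ENNReal.ofReal_mul (norm_nonneg _), ofReal_norm]
        ring

theorem lintegral_enorm_sq_multOp_le {N : ℕ} {S : Set (EuclideanSpace ℝ (Fin n))}
    (hS : IsCompact S) {b : EuclideanSpace ℝ (Fin n) → EuclideanSpace ℝ (Fin n) → (H →L[ℂ] H)}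
    (hb : ∀ x, ContDiff ℝ N (b x)) (hbS : ∀ x, Function.support (b x) ⊆ S) {A R : ℝ} (hR : 0 < R)
    (hA : ∀ x ξ, ‖b x ξ‖ ≤ A) (hA' : ∀ x i ξ, ‖(partialD i)^[N] (b x) ξ‖ ≤ A * (R ^ N)⁻¹)
    (f : 𝓢(EuclideanSpace ℝ (Fin n), H)) (u : EuclideanSpace ℝ (Fin n)) :
    ∫⁻ x, ‖multOp (b x) f (x - u)‖ₑ ^ 2 ≤ (n + 1) * ENNReal.ofReal A ^ 2 * volume S *
      ((∫⁻ z : EuclideanSpace ℝ (Fin n), (kernelWeight N (R • z))⁻¹) * ∫⁻ y, ‖f y‖ₑ ^ 2) := by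
  have hWm : Measurable fun z : EuclideanSpace ℝ (Fin n) => (kernelWeight N (R • z))⁻¹ :=
    ((measurable_kernelWeight N).comp (by fun_prop)).inv
  have hfm : Measurable fun y => ‖f y‖ₑ ^ 2 := f.continuous.enorm.measurable.pow_const 2
  have hm : Measurable (Function.uncurry fun x y : EuclideanSpace ℝ (Fin n) =>
      (kernelWeight N (R • (x - u - y)))⁻¹ * ‖f y‖ₑ ^ 2) :=
    (hWm.comp (by fun_prop : Measurable fun p : EuclideanSpace ℝ (Fin n) ×
      EuclideanSpace ℝ (Fin n) => p.1 - u - p.2)).mul (hfm.comp measurable_snd)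
  calc ∫⁻ x, ‖multOp (b x) f (x - u)‖ₑ ^ 2
      ≤ ∫⁻ x, (n + 1) * ENNReal.ofReal A ^ 2 * volume S *
          ∫⁻ y, (kernelWeight N (R • (x - u - y)))⁻¹ * ‖f y‖ₑ ^ 2 :=
        lintegral_mono fun x =>
          enorm_sq_multOp_le hS (hb x) (hbS x) hR (hA x) (hA' x) f (x - u)
    _ = _ := by
        rw [lintegral_const_mul _ hm.lintegral_prod_right, lintegral_lintegral_swap
          hm.aemeasurable, ← lintegral_const_mul _ hfm]
        congr 1
        refine lintegral_congr fun y => ?_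
        have hWy : Measurable fun x : EuclideanSpace ℝ (Fin n) =>
            (kernelWeight N (R • (x - u - y)))⁻¹ := hWm.comp (by fun_prop :
          Measurable fun x : EuclideanSpace ℝ (Fin n) => x - u - y)
        rw [lintegral_mul_const _ hWy]
        congr 1
        simp only [sub_sub]
        exact lintegral_sub_right_eq_self (fun z => (kernelWeight N (R • z))⁻¹) (u + y)

variable (n H) in
theorem exists_lintegral_enorm_sq_multOp_le {N : ℕ} (hN : n < 2 * N) {c : ℝ} (hc : 0 < c) :
    ∃ K : ℝ, 0 ≤ K ∧ ∀ (b : EuclideanSpace ℝ (Fin n) → EuclideanSpace ℝ (Fin n) → (H →L[ℂ] H))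
      (A R : ℝ), 0 < R → (∀ x, ContDiff ℝ N (b x)) →
      (∀ x, Function.support (b x) ⊆ Metric.closedBall 0 (c * R)) →
      (∀ x ξ, ‖b x ξ‖ ≤ A) → (∀ x i ξ, ‖(partialD i)^[N] (b x) ξ‖ ≤ A * (R ^ N)⁻¹) →
      ∀ (f : 𝓢(EuclideanSpace ℝ (Fin n), H)) (u : EuclideanSpace ℝ (Fin n)),
      ∫⁻ x, ‖multOp (b x) f (x - u)‖ₑ ^ 2 ≤
        ENNReal.ofReal (K * A) ^ 2 * ∫⁻ y, ‖f y‖ₑ ^ 2 := by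
  set Q : ℝ≥0∞ := (n + 1) * (ENNReal.ofReal (c ^ n) *
    volume (Metric.ball (0 : EuclideanSpace ℝ (Fin n)) 1)) *
    ∫⁻ z : EuclideanSpace ℝ (Fin n), (kernelWeight N z)⁻¹ with hQ
  have hQt : Q ≠ ⊤ := by
    refine ENNReal.mul_ne_top (ENNReal.mul_ne_top (by simp) (ENNReal.mul_ne_top (by simp)
      measure_ball_lt_top.ne)) (lintegral_inv_kernelWeight_lt_top hN).ne
  refine ⟨√Q.toReal, Real.sqrt_nonneg _, fun b A R hR hb hbS hA hA' f u => ?_⟩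
  have hA0 : 0 ≤ A := (norm_nonneg _).trans (hA 0 0)
  refine (lintegral_enorm_sq_multOp_le (isCompact_closedBall _ _) hb hbS hR hA hA' f u).trans ?_
  rw [lintegral_comp_smul_pos volume (fun z => (kernelWeight N z)⁻¹) hR,
    Measure.addHaar_closedBall _ _ (by positivity), finrank_euclideanSpace_fin, mul_pow,
    ENNReal.ofReal_mul (by positivity : (0 : ℝ) ≤ c ^ n),
    ENNReal.ofReal_mul (Real.sqrt_nonneg _), mul_pow,
    ← ENNReal.ofReal_pow (Real.sqrt_nonneg _), Real.sq_sqrt ENNReal.toReal_nonneg,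
    ENNReal.ofReal_toReal hQt]
  have h1 : ENNReal.ofReal (R ^ n) * ENNReal.ofReal (R ^ n)⁻¹ = 1 := by
    rw [← ENNReal.ofReal_mul (by positivity), mul_inv_cancel₀ (by positivity), ENNReal.ofReal_one]
  refine le_of_eq ?_
  calc _ = Q * (ENNReal.ofReal (R ^ n) * ENNReal.ofReal (R ^ n)⁻¹) * ENNReal.ofReal A ^ 2 *
        ∫⁻ y, ‖f y‖ₑ ^ 2 := by rw [hQ]; ring
    _ = _ := by rw [h1, mul_one]

end Multiplier

section Localization

variable {n : ℕ}

theorem one_le_bracket (ξ : EuclideanSpace ℝ (Fin n)) : 1 ≤ bracket ξ := by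
  rw [bracket, Real.one_le_sqrt]
  nlinarith [sq_nonneg ‖ξ‖]

theorem norm_le_bracket (ξ : EuclideanSpace ℝ (Fin n)) : ‖ξ‖ ≤ bracket ξ := by
  rw [bracket]
  exact Real.le_sqrt_of_sq_le (by linarith)

/-- Symbol estimates of order zero for the pure derivatives up to order `N`. -/
structure HasSymbolBound {F : Type*} [NormedAddCommGroup F] [NormedSpace ℝ F] (N : ℕ)
    (b : EuclideanSpace ℝ (Fin n) → F) (B : ℝ) : Prop where
  contDiff : ContDiff ℝ N b
  norm_le : ∀ ξ, ‖b ξ‖ ≤ B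
  norm_partialD_le : ∀ i, ∀ k ≤ N, ∀ ξ, ‖(partialD i)^[k] b ξ‖ ≤ B * (bracket ξ ^ k)⁻¹

theorem exists_norm_iterate_partialD_le {F : Type*} [NormedAddCommGroup F] [NormedSpace ℝ F]
    {θ : EuclideanSpace ℝ (Fin n) → F} (hθ : ContDiff ℝ ∞ θ) (hc : HasCompactSupport θ) (N : ℕ) :
    ∃ M : ℝ, 0 ≤ M ∧ (∀ ξ, ‖θ ξ‖ ≤ M) ∧ ∀ i, ∀ k ≤ N, ∀ ξ, ‖(partialD i)^[k] θ ξ‖ ≤ M := by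
  obtain ⟨M₀, hM₀⟩ := hc.exists_bound_of_continuous hθ.continuous
  have h : ∀ (i : Fin n) (k : ℕ), ∃ M, ∀ ξ, ‖(partialD i)^[k] θ ξ‖ ≤ M := fun i k => by
    have hk : ContDiff ℝ (k + 0 : ℕ) θ := hθ.of_le (by exact_mod_cast le_top)
    exact (iterate_partialD_hasCompactSupport i k (by simpa using hk) hc).exists_bound_of_continuous
      (iterate_partialD_contDiff i k 0 hk).continuous
  choose M hM using h
  have hM₀' : 0 ≤ M₀ := (norm_nonneg _).trans (hM₀ 0)
  have hM' : ∀ i k, 0 ≤ M i k := fun i k => (norm_nonneg _).trans (hM i k 0)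
  have hs : 0 ≤ ∑ i, ∑ k ∈ Finset.range (N + 1), M i k :=
    Finset.sum_nonneg fun i _ => Finset.sum_nonneg fun k _ => hM' i k
  refine ⟨M₀ + ∑ i, ∑ k ∈ Finset.range (N + 1), M i k, by positivity, fun ξ => ?_,
    fun i k hk ξ => ?_⟩
  · linarith [hM₀ ξ]
  · have h1 : M i k ≤ ∑ k ∈ Finset.range (N + 1), M i k :=
      Finset.single_le_sum (f := fun k => M i k) (fun k _ => hM' i k)
        (Finset.mem_range.2 (by omega))
    have h2 : ∑ k ∈ Finset.range (N + 1), M i k ≤ ∑ i, ∑ k ∈ Finset.range (N + 1), M i k :=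
      Finset.single_le_sum (f := fun i => ∑ k ∈ Finset.range (N + 1), M i k)
        (fun i _ => Finset.sum_nonneg fun k _ => hM' i k) (Finset.mem_univ i)
    linarith [hM i k ξ]

theorem norm_iterate_partialD_localized_le {F : Type*} [NormedAddCommGroup F] [NormedSpace ℝ F]
    {θ : EuclideanSpace ℝ (Fin n) → ℝ} (hθ : ContDiff ℝ ∞ θ) {N : ℕ} {M : ℝ} (hM0 : 0 ≤ M)
    (hM : ∀ i, ∀ k ≤ N, ∀ ξ, ‖(partialD i)^[k] θ ξ‖ ≤ M) {R : ℝ} (hR : 0 < R)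
    (hRθ : ∀ ξ ∈ tsupport θ, R ≤ bracket (R • ξ)) {b : EuclideanSpace ℝ (Fin n) → F} {B : ℝ}
    (hb : HasSymbolBound N b B) (i : Fin n) (ξ : EuclideanSpace ℝ (Fin n)) :
    ‖(partialD i)^[N] (fun η => θ (R⁻¹ • η) • b η) ξ‖ ≤ 2 ^ N * M * B * (R ^ N)⁻¹ := by
  have hB : 0 ≤ B := (norm_nonneg _).trans (hb.norm_le 0)
  have hθN : ∀ k : ℕ, ContDiff ℝ k θ := fun k => hθ.of_le (by exact_mod_cast le_top)
  have hs : ContDiff ℝ N fun η => θ (R⁻¹ • η) := (hθN N).comp (by fun_prop)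
  refine (norm_iterate_partialD_smul_le hs hb.contDiff i ξ).trans ?_
  have hterm : ∀ l ∈ Finset.range (N + 1),
      (N.choose l : ℝ) * ‖(partialD i)^[l] (fun η => θ (R⁻¹ • η)) ξ‖ *
        ‖(partialD i)^[N - l] b ξ‖ ≤ (N.choose l : ℝ) * (M * B * (R ^ N)⁻¹) := by
    intro l hl
    have hlN : l ≤ N := by simpa [Nat.lt_succ_iff] using hl
    rw [mul_assoc]
    refine mul_le_mul_of_nonneg_left ?_ (by positivity)
    rw [iterate_partialD_comp_smul (hθN l), norm_smul]
    by_cases h0 : (partialD i)^[l] θ (R⁻¹ • ξ) = 0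
    · rw [h0]
      simp only [norm_zero, mul_zero, zero_mul]
      positivity
    · have hmem := support_iterate_partialD_subset θ i l h0
      have hbr : R ≤ bracket ξ := by simpa [smul_smul, hR.ne'] using hRθ _ hmem
      have h1 := hb.norm_partialD_le i (N - l) (by omega) ξ
      have h2 : (bracket ξ ^ (N - l))⁻¹ ≤ (R ^ (N - l))⁻¹ := by gcongr
      have h3 : R ^ N = R ^ l * R ^ (N - l) := by rw [← pow_add]; congr 1; omega
      rw [norm_pow, norm_inv, Real.norm_eq_abs, abs_of_pos hR, inv_pow, h3, mul_inv]
      calc (R ^ l)⁻¹ * ‖(partialD i)^[l] θ (R⁻¹ • ξ)‖ * ‖(partialD i)^[N - l] b ξ‖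
          ≤ (R ^ l)⁻¹ * M * (B * (R ^ (N - l))⁻¹) := by
            gcongr
            · exact hM i l hlN _
            · exact h1.trans (by gcongr)
        _ = _ := by ring
  refine (Finset.sum_le_sum hterm).trans (le_of_eq ?_)
  rw [← Finset.sum_mul, ← Nat.cast_sum, Nat.sum_range_choose]
  push_cast
  ring

variable {H : Type*} [NormedAddCommGroup H] [InnerProductSpace ℂ H] [CompleteSpace H]

variable (H) in
/-- `L²` boundedness, uniform in the scale `R`, of frequency-localized operators. -/
theorem exists_localized_bound {N : ℕ} (hN : n < 2 * N) {θ : EuclideanSpace ℝ (Fin n) → ℝ}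
    (hθ : ContDiff ℝ ∞ θ) (hc : HasCompactSupport θ) :
    ∃ K : ℝ, 0 ≤ K ∧ ∀ (R : ℝ), 0 < R → (∀ ξ ∈ tsupport θ, R ≤ bracket (R • ξ)) →
      ∀ (b : EuclideanSpace ℝ (Fin n) → EuclideanSpace ℝ (Fin n) → (H →L[ℂ] H)) (B : ℝ),
      (∀ x, HasSymbolBound N (b x) B) →
      ∀ (f : 𝓢(EuclideanSpace ℝ (Fin n), H)) (u : EuclideanSpace ℝ (Fin n)),
      ∫⁻ x, ‖multOp (fun ξ => θ (R⁻¹ • ξ) • b x ξ) f (x - u)‖ₑ ^ 2 ≤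
        ENNReal.ofReal (K * B) ^ 2 * ∫⁻ y, ‖f y‖ₑ ^ 2 := by
  obtain ⟨M, hM0, hM, hM'⟩ := exists_norm_iterate_partialD_le hθ hc N
  obtain ⟨c, hc0, hcs⟩ : ∃ c : ℝ, 0 < c ∧ tsupport θ ⊆ Metric.closedBall 0 c := by
    obtain ⟨c, hcs⟩ := hc.isCompact.isBounded.subset_closedBall 0
    exact ⟨max c 1, by positivity, hcs.trans (Metric.closedBall_subset_closedBall (le_max_left _ _))⟩
  obtain ⟨K, hK0, hK⟩ := exists_lintegral_enorm_sq_multOp_le n H hN hc0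
  refine ⟨K * (2 ^ N * M), by positivity, fun R hR hRθ b B hb f u => ?_⟩
  have hB : 0 ≤ B := (norm_nonneg _).trans ((hb 0).norm_le 0)
  have h2 : (1 : ℝ) ≤ 2 ^ N := one_le_pow₀ (by norm_num)
  have := hK (fun x ξ => θ (R⁻¹ • ξ) • b x ξ) (2 ^ N * M * B) R hR
    (fun x => ((hθ.of_le (by exact_mod_cast le_top)).comp (by fun_prop)).smul (hb x).contDiff)
    (fun x ξ hξ => ?_) (fun x ξ => ?_)
    (fun x i ξ => norm_iterate_partialD_localized_le hθ hM0 hM' hR hRθ (hb x) i ξ) f u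
  · simpa only [mul_assoc] using this
  · have h1 : θ (R⁻¹ • ξ) ≠ 0 := fun h => hξ (by simp [h])
    have h3 := hcs (subset_tsupport θ h1)
    rw [mem_closedBall_zero_iff, norm_smul, norm_inv, Real.norm_eq_abs, abs_of_pos hR,
      inv_mul_le_iff₀ hR] at h3
    rw [mem_closedBall_zero_iff]
    linarith
  · rw [norm_smul]
    calc ‖θ (R⁻¹ • ξ)‖ * ‖b x ξ‖ ≤ M * B := by
          gcongr
          · exact hM _
          · exact (hb x).norm_le ξ
      _ ≤ 2 ^ N * M * B := by
          rw [mul_assoc]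
          exact le_mul_of_one_le_left (by positivity) h2

end Localization

section Cutoffs

variable {n : ℕ}

/-- A smooth radial bump, equal to `1` on the unit ball and vanishing outside the ball of
radius `2`. -/
noncomputable def freqBump (n : ℕ) : ContDiffBump (0 : EuclideanSpace ℝ (Fin n)) :=
  ⟨1, 2, one_pos, one_lt_two⟩

/-- The cutoff to frequencies `|ξ| ≲ 4 ^ j`. -/
noncomputable def lowCut (j : ℤ) (ξ : EuclideanSpace ℝ (Fin n)) : ℝ :=
  freqBump n ((4 : ℝ) ^ (-j) • ξ)

/-- The cutoff to frequencies `|ξ| ∼ 4 ^ j`. -/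
noncomputable def bandCut (j : ℕ) (ξ : EuclideanSpace ℝ (Fin n)) : ℝ :=
  lowCut (j + 1) ξ - lowCut j ξ

/-- A wider cutoff to frequencies `|ξ| ∼ 4 ^ j`, equal to `1` on the support of `bandCut j`. -/
noncomputable def wideCut (j : ℕ) (ξ : EuclideanSpace ℝ (Fin n)) : ℝ :=
  lowCut (j + 2) ξ - lowCut (j - 1) ξ

theorem lowCut_contDiff (j : ℤ) :
    ContDiff ℝ ∞ (lowCut j : EuclideanSpace ℝ (Fin n) → ℝ) :=
  (freqBump n).contDiff.comp (by fun_prop)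

theorem norm_zpow_smul (j : ℤ) (ξ : EuclideanSpace ℝ (Fin n)) :
    ‖(4 : ℝ) ^ (-j) • ξ‖ = ‖ξ‖ / 4 ^ j := by
  rw [norm_smul, norm_zpow, zpow_neg]
  norm_num
  ring

theorem lowCut_eq_one {j : ℤ} {ξ : EuclideanSpace ℝ (Fin n)} (h : ‖ξ‖ ≤ 4 ^ j) :
    lowCut j ξ = 1 := by
  refine (freqBump n).one_of_mem_closedBall ?_
  rw [mem_closedBall_zero_iff, norm_zpow_smul]
  exact (div_le_one (by positivity)).2 h

theorem lowCut_eq_zero {j : ℤ} {ξ : EuclideanSpace ℝ (Fin n)} (h : 2 * 4 ^ j ≤ ‖ξ‖) :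
    lowCut j ξ = 0 := by
  refine (freqBump n).zero_of_le_dist ?_
  rw [dist_zero_right, norm_zpow_smul]
  exact (le_div_iff₀ (by positivity)).2 h

theorem lowCut_nonneg (j : ℤ) (ξ : EuclideanSpace ℝ (Fin n)) : 0 ≤ lowCut j ξ :=
  (freqBump n).nonneg

theorem lowCut_le_one (j : ℤ) (ξ : EuclideanSpace ℝ (Fin n)) : lowCut j ξ ≤ 1 :=
  (freqBump n).le_one

theorem lowCut_mono (ξ : EuclideanSpace ℝ (Fin n)) : Monotone fun j : ℤ => lowCut j ξ := by
  refine monotone_int_of_le_succ fun j => ?_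
  rcases le_total (2 * 4 ^ j) ‖ξ‖ with h | h
  · rw [lowCut_eq_zero h]
    exact lowCut_nonneg _ _
  · rw [lowCut_eq_one (j := j + 1)]
    · exact lowCut_le_one _ _
    · rw [zpow_add_one₀ (by norm_num)]
      have : (0 : ℝ) < 4 ^ j := by positivity
      linarith

theorem lowCut_hasCompactSupport (j : ℤ) :
    HasCompactSupport (lowCut j : EuclideanSpace ℝ (Fin n) → ℝ) := by
  refine HasCompactSupport.of_support_subset_isCompact
    (isCompact_closedBall (0 : EuclideanSpace ℝ (Fin n)) (2 * 4 ^ j)) fun ξ hξ => ?_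
  rw [mem_closedBall_zero_iff]
  by_contra h
  exact hξ (lowCut_eq_zero (not_le.1 h).le)

theorem lowCut_scale (j : ℕ) (k : ℤ) (ξ : EuclideanSpace ℝ (Fin n)) :
    lowCut (j + k) ξ = lowCut k (((4 : ℝ) ^ j)⁻¹ • ξ) := by
  rw [lowCut, lowCut, smul_smul, neg_add, zpow_add₀ (by norm_num), mul_comm,
    zpow_neg _ (j : ℤ), zpow_natCast]

theorem bandCut_eq (j : ℕ) (ξ : EuclideanSpace ℝ (Fin n)) :
    bandCut j ξ = bandCut 0 (((4 : ℝ) ^ j)⁻¹ • ξ) := by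
  have h := lowCut_scale j 0 ξ
  rw [add_zero] at h
  rw [bandCut, bandCut, lowCut_scale, h]
  simp

theorem wideCut_eq (j : ℕ) (ξ : EuclideanSpace ℝ (Fin n)) :
    wideCut j ξ = wideCut 0 (((4 : ℝ) ^ j)⁻¹ • ξ) := by
  rw [wideCut, wideCut, lowCut_scale, sub_eq_add_neg (j : ℤ), lowCut_scale]
  simp

theorem bandCut_contDiff (j : ℕ) :
    ContDiff ℝ ∞ (bandCut j : EuclideanSpace ℝ (Fin n) → ℝ) :=
  (lowCut_contDiff _).sub (lowCut_contDiff _)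

theorem wideCut_contDiff (j : ℕ) :
    ContDiff ℝ ∞ (wideCut j : EuclideanSpace ℝ (Fin n) → ℝ) :=
  (lowCut_contDiff _).sub (lowCut_contDiff _)

theorem bandCut_hasCompactSupport (j : ℕ) :
    HasCompactSupport (bandCut j : EuclideanSpace ℝ (Fin n) → ℝ) :=
  (lowCut_hasCompactSupport _).sub (lowCut_hasCompactSupport _)

theorem wideCut_hasCompactSupport (j : ℕ) :
    HasCompactSupport (wideCut j : EuclideanSpace ℝ (Fin n) → ℝ) :=
  (lowCut_hasCompactSupport _).sub (lowCut_hasCompactSupport _)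

theorem le_norm_of_bandCut_ne_zero {j : ℕ} {ξ : EuclideanSpace ℝ (Fin n)} (h : bandCut j ξ ≠ 0) :
    (4 : ℝ) ^ j ≤ ‖ξ‖ := by
  by_contra hlt
  rw [not_le] at hlt
  apply h
  rw [bandCut, lowCut_eq_one, lowCut_eq_one, sub_self]
  · simpa using hlt.le
  · rw [zpow_add_one₀ (by norm_num), zpow_natCast]
    have : (0 : ℝ) < 4 ^ j := by positivity
    linarith

theorem norm_le_of_bandCut_ne_zero {j : ℕ} {ξ : EuclideanSpace ℝ (Fin n)} (h : bandCut j ξ ≠ 0) :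
    ‖ξ‖ ≤ 8 * (4 : ℝ) ^ j := by
  by_contra hlt
  rw [not_le] at hlt
  apply h
  have : (0 : ℝ) < 4 ^ j := by positivity
  rw [bandCut, lowCut_eq_zero, lowCut_eq_zero, sub_self]
  · rw [zpow_natCast]
    linarith
  · rw [zpow_add_one₀ (by norm_num), zpow_natCast]
    linarith

theorem bandCut_mul_wideCut (j : ℕ) (ξ : EuclideanSpace ℝ (Fin n)) :
    bandCut j ξ * wideCut j ξ = bandCut j ξ := by
  rcases eq_or_ne (bandCut j ξ) 0 with h | h
  · simp [h]
  have h1 := le_norm_of_bandCut_ne_zero h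
  have h2 := norm_le_of_bandCut_ne_zero h
  have : (0 : ℝ) < 4 ^ j := by positivity
  rw [wideCut, lowCut_eq_one (j := (j : ℤ) + 2), lowCut_eq_zero (j := (j : ℤ) - 1), sub_zero,
    mul_one]
  · rw [zpow_sub_one₀ (by norm_num), zpow_natCast]
    linarith
  · rw [zpow_add₀ (by norm_num), zpow_natCast]
    norm_num
    linarith

theorem one_le_norm_of_mem_tsupport_bandCut {ξ : EuclideanSpace ℝ (Fin n)}
    (h : ξ ∈ tsupport (bandCut 0 : EuclideanSpace ℝ (Fin n) → ℝ)) : 1 ≤ ‖ξ‖ := by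
  have hc : IsClosed {ξ : EuclideanSpace ℝ (Fin n) | 1 ≤ ‖ξ‖} :=
    isClosed_le continuous_const continuous_norm
  exact closure_minimal (fun η hη => by simpa using le_norm_of_bandCut_ne_zero hη) hc h

theorem wideCut_nonneg (j : ℕ) (ξ : EuclideanSpace ℝ (Fin n)) : 0 ≤ wideCut j ξ :=
  sub_nonneg.2 (lowCut_mono ξ (by omega))

theorem wideCut_le_one (j : ℕ) (ξ : EuclideanSpace ℝ (Fin n)) : wideCut j ξ ≤ 1 := by
  have h1 := lowCut_le_one (j + 2 : ℤ) ξ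
  have h2 := lowCut_nonneg (j - 1 : ℤ) ξ
  rw [wideCut]
  linarith

theorem sum_wideCut_sq_le (J : ℕ) (ξ : EuclideanSpace ℝ (Fin n)) :
    ∑ j ∈ Finset.range J, wideCut j ξ ^ 2 ≤ 3 := by
  have h1 : ∀ j : ℕ, wideCut j ξ ^ 2 ≤ wideCut j ξ := fun j => by
    nlinarith [wideCut_nonneg j ξ, wideCut_le_one j ξ]
  have h2 : ∀ J : ℕ, ∑ j ∈ Finset.range J, wideCut j ξ =
      (lowCut (J + 1) ξ + lowCut J ξ + lowCut (J - 1) ξ) -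
        (lowCut 1 ξ + lowCut 0 ξ + lowCut (-1) ξ) := by
    intro J
    induction J with
    | zero => simp
    | succ J ih =>
      rw [Finset.sum_range_succ, ih, wideCut]
      push_cast
      rw [show (J : ℤ) + 1 + 1 = J + 2 by ring, show (J : ℤ) + 1 - 1 = J by ring]
      ring
  refine (Finset.sum_le_sum fun j _ => h1 j).trans ?_
  rw [h2]
  have := lowCut_le_one (J + 1 : ℤ) ξ
  have := lowCut_le_one (J : ℤ) ξ
  have := lowCut_le_one (J - 1 : ℤ) ξ
  have := lowCut_nonneg (1 : ℤ) ξ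
  have := lowCut_nonneg (0 : ℤ) ξ
  have := lowCut_nonneg (-1 : ℤ) ξ
  linarith

theorem tendsto_lowCut (ξ : EuclideanSpace ℝ (Fin n)) :
    Filter.Tendsto (fun J : ℕ => lowCut (J : ℤ) ξ) Filter.atTop (nhds 1) := by
  refine tendsto_const_nhds.congr' ?_
  have h := tendsto_pow_atTop_atTop_of_one_lt (show (1 : ℝ) < 4 by norm_num)
  filter_upwards [h.eventually_ge_atTop ‖ξ‖] with J hJ
  rw [lowCut_eq_one]
  simpa using hJ

end Cutoffs

section Projections

variable {n : ℕ} {H : Type*} [NormedAddCommGroup H] [InnerProductSpace ℂ H] [CompleteSpace H]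

theorem wideCut_hasTemperateGrowth (j : ℕ) :
    (wideCut j : EuclideanSpace ℝ (Fin n) → ℝ).HasTemperateGrowth :=
  ((wideCut_hasCompactSupport j).toSchwartzMap (wideCut_contDiff j)).hasTemperateGrowth

/-- The Littlewood–Paley projection with symbol `wideCut j`. -/
noncomputable def wideProj (j : ℕ) (f : 𝓢(EuclideanSpace ℝ (Fin n), H)) :
    𝓢(EuclideanSpace ℝ (Fin n), H) :=
  𝓕⁻ (SchwartzMap.smulLeftCLM H (wideCut j) (𝓕 f))

theorem fourier_wideProj (j : ℕ) (f : 𝓢(EuclideanSpace ℝ (Fin n), H))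
    (ξ : EuclideanSpace ℝ (Fin n)) :
    𝓕 (wideProj j f : EuclideanSpace ℝ (Fin n) → H) ξ =
      wideCut j ξ • 𝓕 (f : EuclideanSpace ℝ (Fin n) → H) ξ := by
  rw [← SchwartzMap.fourier_coe, wideProj, FourierTransform.fourier_fourierInv_eq,
    SchwartzMap.smulLeftCLM_apply_apply (wideCut_hasTemperateGrowth j), SchwartzMap.fourier_coe]

theorem multOp_bandCut_wideProj (j : ℕ) (b : EuclideanSpace ℝ (Fin n) → (H →L[ℂ] H))
    (f : 𝓢(EuclideanSpace ℝ (Fin n), H)) :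
    multOp (fun ξ => bandCut j ξ • b ξ) (wideProj j f) =
      multOp (fun ξ => bandCut j ξ • b ξ) f := by
  unfold multOp
  congr 1
  ext ξ
  rw [fourier_wideProj, ContinuousLinearMap.map_smul_of_tower, smul_apply,
    smul_smul, mul_comm, bandCut_mul_wideCut]

/-- The `L²` norm of a Schwartz function. -/
noncomputable def l2Norm (f : 𝓢(EuclideanSpace ℝ (Fin n), H)) : ℝ := ‖f.toLp 2 volume‖

theorem l2Norm_nonneg (f : 𝓢(EuclideanSpace ℝ (Fin n), H)) : 0 ≤ l2Norm f := norm_nonneg _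

theorem lintegral_enorm_sq_schwartz (f : 𝓢(EuclideanSpace ℝ (Fin n), H)) :
    ∫⁻ x, ‖f x‖ₑ ^ 2 = ENNReal.ofReal (l2Norm f) ^ 2 := by
  rw [l2Norm, ofReal_norm, Lp.enorm_def, eLpNorm_congr_ae (f.coeFn_toLp 2 volume)]
  have h := eLpNorm_nnreal_pow_eq_lintegral (p := 2) (f := f)
    (μ := (volume : Measure (EuclideanSpace ℝ (Fin n)))) two_ne_zero
  simpa using h.symm

theorem sum_norm_sq_wideProj_le (J : ℕ) (f : 𝓢(EuclideanSpace ℝ (Fin n), H)) :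
    ∑ j ∈ Finset.range J, l2Norm (wideProj j f) ^ 2 ≤ 3 * l2Norm f ^ 2 := by
  have hFf : Measurable fun ξ => ‖𝓕 (f : EuclideanSpace ℝ (Fin n) → H) ξ‖ₑ ^ 2 :=
    (continuous_fourier_of_integrable f.integrable).enorm.measurable.pow_const 2
  have h1 : ∀ j, ENNReal.ofReal (l2Norm (wideProj j f) ^ 2) =
      ∫⁻ ξ, ENNReal.ofReal (wideCut j ξ ^ 2) *
        ‖𝓕 (f : EuclideanSpace ℝ (Fin n) → H) ξ‖ₑ ^ 2 := by
    intro j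
    rw [ENNReal.ofReal_pow (l2Norm_nonneg _), ← lintegral_enorm_sq_schwartz,
      ← lintegral_enorm_sq_fourier (wideProj j f).integrable ((wideProj j f).memLp 2)]
    refine lintegral_congr fun ξ => ?_
    rw [fourier_wideProj, enorm_smul, mul_pow, Real.enorm_eq_ofReal (wideCut_nonneg _ _),
      ENNReal.ofReal_pow (wideCut_nonneg _ _)]
  rw [← ENNReal.ofReal_le_ofReal_iff (by have := l2Norm_nonneg f; positivity),
    ENNReal.ofReal_sum_of_nonneg (fun j _ => by positivity)]
  simp only [h1]
  have hm : ∀ j, Measurable fun ξ => ENNReal.ofReal (wideCut j ξ ^ 2) *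
      ‖𝓕 (f : EuclideanSpace ℝ (Fin n) → H) ξ‖ₑ ^ 2 := fun j =>
    (Measurable.ennreal_ofReal ((wideCut_contDiff j).continuous.measurable.pow_const 2)).mul hFf
  rw [← lintegral_finsetSum _ (fun j _ => hm j)]
  calc _ ≤ ∫⁻ ξ, 3 * ‖𝓕 (f : EuclideanSpace ℝ (Fin n) → H) ξ‖ₑ ^ 2 := by
        refine lintegral_mono fun ξ => ?_
        rw [← Finset.sum_mul, ← ENNReal.ofReal_sum_of_nonneg (fun j _ => by positivity)]
        gcongr
        simpa using ENNReal.ofReal_le_ofReal (sum_wideCut_sq_le J ξ)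
    _ = _ := by
        rw [lintegral_const_mul _ hFf, lintegral_enorm_sq_fourier f.integrable (f.memLp 2),
          lintegral_enorm_sq_schwartz, ENNReal.ofReal_mul (by norm_num),
          ENNReal.ofReal_pow (l2Norm_nonneg _)]
        simp

/-- `wideCut j` as a complex-valued Schwartz function. -/
noncomputable def wideSchwartz (n j : ℕ) : 𝓢(EuclideanSpace ℝ (Fin n), ℂ) :=
  ((wideCut_hasCompactSupport j).comp_left (g := fun r : ℝ => (r : ℂ)) (by simp)).toSchwartzMap
    (Complex.ofRealCLM.contDiff.comp (wideCut_contDiff j))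

theorem wideSchwartz_apply (j : ℕ) (ξ : EuclideanSpace ℝ (Fin n)) :
    wideSchwartz n j ξ = wideCut j ξ := rfl

/-- The convolution kernel of `wideProj j`. -/
noncomputable def wideKernel (n j : ℕ) : 𝓢(EuclideanSpace ℝ (Fin n), ℂ) := 𝓕⁻ (wideSchwartz n j)

theorem wideKernel_eq (j : ℕ) (u : EuclideanSpace ℝ (Fin n)) :
    wideKernel n j u = ((4 : ℝ) ^ j) ^ n • wideKernel n 0 ((4 : ℝ) ^ j • u) := by
  have h4 : (0 : ℝ) < 4 ^ j := by positivity
  simp only [wideKernel, SchwartzMap.fourierInv_coe, Real.fourierInv_eq]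
  have h := Measure.integral_comp_inv_smul_of_nonneg (volume : Measure (EuclideanSpace ℝ (Fin n)))
    (fun ξ => Real.fourierChar (inner ℝ ξ ((4 : ℝ) ^ j • u)) • wideSchwartz n 0 ξ) h4.le
  rw [finrank_euclideanSpace_fin] at h
  rw [← h]
  congr 1
  ext ξ
  rw [inner_smul_left, inner_smul_right]
  simp only [wideSchwartz_apply]
  rw [wideCut_eq j ξ]
  congr 3
  simp

theorem integral_norm_wideKernel (j : ℕ) :
    ∫ u, ‖wideKernel n j u‖ = ∫ u, ‖wideKernel n 0 u‖ := by
  have h4 : (0 : ℝ) < 4 ^ j := by positivity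
  have h := Measure.integral_comp_smul_of_nonneg (volume : Measure (EuclideanSpace ℝ (Fin n)))
    (fun u => ‖wideKernel n 0 u‖) ((4 : ℝ) ^ j) (hR := h4.le)
  rw [finrank_euclideanSpace_fin] at h
  simp only [wideKernel_eq j, norm_smul, norm_pow, Real.norm_of_nonneg h4.le]
  rw [integral_const_mul, h, smul_eq_mul, ← mul_assoc, mul_inv_cancel₀ (by positivity), one_mul]

theorem integral_norm_mul_norm_wideKernel (j : ℕ) :
    ∫ u, ‖u‖ * ‖wideKernel n j u‖ = ((4 : ℝ) ^ j)⁻¹ * ∫ u, ‖u‖ * ‖wideKernel n 0 u‖ := by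
  have h4 : (0 : ℝ) < 4 ^ j := by positivity
  have h := Measure.integral_comp_smul_of_nonneg (volume : Measure (EuclideanSpace ℝ (Fin n)))
    (fun u => ‖u‖ * ‖wideKernel n 0 u‖) ((4 : ℝ) ^ j) (hR := h4.le)
  rw [finrank_euclideanSpace_fin] at h
  have e : ∀ u : EuclideanSpace ℝ (Fin n), ‖u‖ * ‖wideKernel n j u‖ =
      (((4 : ℝ) ^ j)⁻¹ * ((4 : ℝ) ^ j) ^ n) *
        (‖(4 : ℝ) ^ j • u‖ * ‖wideKernel n 0 ((4 : ℝ) ^ j • u)‖) := by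
    intro u
    rw [wideKernel_eq j, norm_smul, norm_smul, norm_pow, Real.norm_of_nonneg h4.le]
    field_simp
  simp only [e]
  rw [integral_const_mul, h, smul_eq_mul]
  field_simp

theorem wideProj_apply (j : ℕ) (g : 𝓢(EuclideanSpace ℝ (Fin n), H))
    (x : EuclideanSpace ℝ (Fin n)) :
    wideProj j g x = ∫ u, (starRingEnd ℂ) (wideKernel n j u) • g (x + u) := by
  have h1 : wideProj j g x = ∫ ξ, wideSchwartz n j ξ • 𝓕 (fun y => g (y + x)) ξ := by
    rw [wideProj, SchwartzMap.fourierInv_coe, Real.fourierInv_eq]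
    congr 1
    ext ξ
    rw [fourier_comp_add_right, SchwartzMap.smulLeftCLM_apply_apply (wideCut_hasTemperateGrowth j),
      wideSchwartz_apply, Complex.coe_smul, smul_comm, SchwartzMap.fourier_coe]
  have h2 := VectorFourier.integral_fourierIntegral_smul_eq_flip (μ := volume) (ν := volume)
      (L := innerₗ (EuclideanSpace ℝ (Fin n))) Real.continuous_fourierChar
      (by exact continuous_inner) (wideSchwartz n j).integrable (g.integrable.comp_add_right x)
  rw [flip_innerₗ] at h2
  rw [h1]
  refine Eq.trans h2.symm ?_
  congr 1
  ext u
  rw [add_comm x u]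
  congr 1
  rw [wideKernel, SchwartzMap.fourierInv_coe, Real.fourierInv_eq, ← integral_conj]
  refine integral_congr_ae (Filter.Eventually.of_forall fun ξ => ?_)
  simp only [wideSchwartz_apply, Circle.smul_def, smul_eq_mul, map_mul, Complex.conj_ofReal,
    ← Circle.coe_inv_eq_conj, ← AddChar.map_neg_eq_inv]
  rfl

theorem integral_wideKernel_smul_fourierInv (j : ℕ) {h : EuclideanSpace ℝ (Fin n) → H}
    (hh : Integrable h) (x : EuclideanSpace ℝ (Fin n)) :
    ∫ u, wideKernel n j u • 𝓕⁻ h (x - u) = 𝓕⁻ (fun ξ => wideCut j ξ • h ξ) x := by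
  have hh' : Integrable fun ξ => Real.fourierChar (inner ℝ ξ x) • h ξ := by
    have := (Real.fourierIntegral_convergent_iff (f := h) (-x)).2 hh
    simpa using this
  have h2 := VectorFourier.integral_fourierIntegral_smul_eq_flip (μ := volume) (ν := volume)
      (L := innerₗ (EuclideanSpace ℝ (Fin n))) Real.continuous_fourierChar
      (by exact continuous_inner) (wideKernel n j).integrable hh'
  rw [flip_innerₗ] at h2
  have h3 : ∀ ξ, VectorFourier.fourierIntegral Real.fourierChar volume
      (innerₗ (EuclideanSpace ℝ (Fin n))) (wideKernel n j) ξ = wideCut j ξ := fun ξ => by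
    change 𝓕 (wideKernel n j : EuclideanSpace ℝ (Fin n) → ℂ) ξ = _
    rw [← SchwartzMap.fourier_coe, wideKernel, FourierTransform.fourier_fourierInv_eq]
    rfl
  rw [Real.fourierInv_eq]
  simp only [h3] at h2
  refine (Eq.trans ?_ h2.symm).trans ?_
  · congr 1
    ext u
    congr 1
    rw [Real.fourierInv_eq]
    refine integral_congr_ae (Filter.Eventually.of_forall fun ξ => ?_)
    simp only [smul_smul, ← AddChar.map_add_eq_mul, inner_sub_right, innerₗ_apply_apply]
    congr 2
    ring
  · congr 1
    ext ξ
    rw [Complex.coe_smul, smul_comm]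

end Projections

section Pairing

variable {n : ℕ} {H : Type*} [NormedAddCommGroup H] [InnerProductSpace ℂ H] [CompleteSpace H]

theorem inner_integral_left {α : Type*} [MeasurableSpace α] {μ : Measure α} {f : α → H}
    (hf : Integrable f μ) (c : H) : ⟪∫ a, f a ∂μ, c⟫_ℂ = ∫ a, ⟪f a, c⟫_ℂ ∂μ := by
  rw [← inner_conj_symm, ← integral_inner hf, ← integral_conj]
  simp only [inner_conj_symm]

theorem norm_integral_inner_le {α : Type*} [MeasurableSpace α] {μ : Measure α} {f g : α → H}
    (hf : AEStronglyMeasurable f μ) (hg : AEStronglyMeasurable g μ) {a b : ℝ} (ha : 0 ≤ a)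
    (hb : 0 ≤ b) (hfa : ∫⁻ x, ‖f x‖ₑ ^ 2 ∂μ ≤ ENNReal.ofReal a ^ 2)
    (hgb : ∫⁻ x, ‖g x‖ₑ ^ 2 ∂μ ≤ ENNReal.ofReal b ^ 2) : ‖∫ x, ⟪f x, g x⟫_ℂ ∂μ‖ ≤ a * b := by
  have h1 : ‖∫ x, ⟪f x, g x⟫_ℂ ∂μ‖ₑ ≤ ∫⁻ x, ‖f x‖ₑ * ‖g x‖ₑ ∂μ := by
    refine (enorm_integral_le_lintegral_enorm _).trans (lintegral_mono fun y => ?_)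
    rw [← ofReal_norm, ← ofReal_norm, ← ofReal_norm, ← ENNReal.ofReal_mul (norm_nonneg _)]
    exact ENNReal.ofReal_le_ofReal (norm_inner_le_norm _ _)
  have h2 := (pow_le_pow_left' h1 2).trans ((sq_lintegral_mul_le μ hf.enorm hg.enorm).trans
    (mul_le_mul' hfa hgb))
  rw [← ofReal_norm, ← mul_pow, ← ENNReal.ofReal_mul ha, ← ENNReal.ofReal_pow (norm_nonneg _),
    ← ENNReal.ofReal_pow (by positivity), ENNReal.ofReal_le_ofReal_iff (by positivity)] at h2
  exact le_of_sq_le_sq h2 (by positivity)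

variable {a : EuclideanSpace ℝ (Fin n) → EuclideanSpace ℝ (Fin n) → (H →L[ℂ] H)} {A : ℝ}

theorem norm_symbol_apply_le {b : EuclideanSpace ℝ (Fin n) → (H →L[ℂ] H)}
    (hA : ∀ ξ, ‖b ξ‖ ≤ A) (f : EuclideanSpace ℝ (Fin n) → H) (ξ : EuclideanSpace ℝ (Fin n)) :
    ‖b ξ (𝓕 f ξ)‖ ≤ A * ‖𝓕 f ξ‖ :=
  ((b ξ).le_opNorm _).trans (by gcongr; exact hA ξ)

theorem integrable_fourier_schwartz (f : 𝓢(EuclideanSpace ℝ (Fin n), H)) :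
    Integrable (𝓕 (f : EuclideanSpace ℝ (Fin n) → H)) := by
  rw [← SchwartzMap.fourier_coe]
  exact (𝓕 f).integrable

theorem integrable_symbol_apply {b : EuclideanSpace ℝ (Fin n) → (H →L[ℂ] H)} (hb : Continuous b)
    (hA : ∀ ξ, ‖b ξ‖ ≤ A) (f : 𝓢(EuclideanSpace ℝ (Fin n), H)) :
    Integrable fun ξ => b ξ (𝓕 (f : EuclideanSpace ℝ (Fin n) → H) ξ) :=
  ((integrable_fourier_schwartz f).norm.const_mul A).mono'
    (hb.clm_apply (continuous_fourier_of_integrable f.integrable)).aestronglyMeasurable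
    (Filter.Eventually.of_forall fun ξ => norm_symbol_apply_le hA f ξ)

theorem norm_multOp_le {b : EuclideanSpace ℝ (Fin n) → (H →L[ℂ] H)}
    (hA : ∀ ξ, ‖b ξ‖ ≤ A) (f : 𝓢(EuclideanSpace ℝ (Fin n), H)) (x : EuclideanSpace ℝ (Fin n)) :
    ‖multOp b f x‖ ≤ A * ∫ ξ, ‖𝓕 (f : EuclideanSpace ℝ (Fin n) → H) ξ‖ := by
  rw [multOp_apply, ← integral_const_mul]
  refine norm_integral_le_of_norm_le ((integrable_fourier_schwartz f).norm.const_mul A)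
    (Filter.Eventually.of_forall fun ξ => ?_)
  rw [Circle.norm_smul]
  exact norm_symbol_apply_le hA f ξ

theorem multOp_sub {b b' : EuclideanSpace ℝ (Fin n) → (H →L[ℂ] H)} (hb : Continuous b)
    (hb' : Continuous b') (hA : ∀ ξ, ‖b ξ‖ ≤ A) (hA' : ∀ ξ, ‖b' ξ‖ ≤ A)
    (f : 𝓢(EuclideanSpace ℝ (Fin n), H)) (x : EuclideanSpace ℝ (Fin n)) :
    multOp (fun ξ => b ξ - b' ξ) f x = multOp b f x - multOp b' f x := by
  have h : ∀ {c : EuclideanSpace ℝ (Fin n) → (H →L[ℂ] H)}, Continuous c → (∀ ξ, ‖c ξ‖ ≤ A) →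
      Integrable fun ξ => Real.fourierChar (inner ℝ ξ x) •
        c ξ (𝓕 (f : EuclideanSpace ℝ (Fin n) → H) ξ) := fun hc hcA => by
    simpa using (Real.fourierIntegral_convergent_iff (-x)).2 (integrable_symbol_apply hc hcA f)
  simp only [multOp_apply]
  rw [← integral_sub (h hb hA) (h hb' hA')]
  simp only [sub_apply, smul_sub]

theorem continuous_multOp {X : Type*} [TopologicalSpace X] [FirstCountableTopology X]
    (ha : ∀ ξ, Continuous fun x => a x ξ) (ha' : ∀ x, Continuous (a x))
    (hA : ∀ x ξ, ‖a x ξ‖ ≤ A) (f : 𝓢(EuclideanSpace ℝ (Fin n), H))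
    {φ ψ : X → EuclideanSpace ℝ (Fin n)} (hφ : Continuous φ) (hψ : Continuous ψ) :
    Continuous fun p => multOp (a (φ p)) f (ψ p) := by
  simp only [multOp_apply]
  refine continuous_of_dominated (bound := fun ξ =>
    A * ‖𝓕 (f : EuclideanSpace ℝ (Fin n) → H) ξ‖) (fun p => ?_)
    (fun p => Filter.Eventually.of_forall fun ξ => ?_)
    ((integrable_fourier_schwartz f).norm.const_mul A)
    (Filter.Eventually.of_forall fun ξ => ?_)
  · have h1 : Continuous fun ξ : EuclideanSpace ℝ (Fin n) =>
        Real.fourierChar (inner ℝ ξ (ψ p)) := Real.continuous_fourierChar.comp (by fun_prop)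
    exact (h1.smul ((ha' (φ p)).clm_apply
      (continuous_fourier_of_integrable f.integrable))).aestronglyMeasurable
  · rw [Circle.norm_smul]
    exact norm_symbol_apply_le (hA (φ p)) f ξ
  · have h1 : Continuous fun p => Real.fourierChar (inner ℝ ξ (ψ p)) :=
      Real.continuous_fourierChar.comp (by fun_prop)
    exact h1.smul (((ha ξ).comp hφ).clm_apply continuous_const)

theorem integral_inner_sub_wideProj (j : ℕ) (ha : ∀ ξ, Continuous fun x => a x ξ)
    (ha' : ∀ x, Continuous (a x)) (hA : ∀ x ξ, ‖a x ξ‖ ≤ A)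
    (haw : ∀ x ξ, wideCut j ξ • a x ξ = a x ξ) (f g : 𝓢(EuclideanSpace ℝ (Fin n), H)) :
    (∫ x, ⟪multOp (a x) f x, g x⟫_ℂ) - ∫ x, ⟪multOp (a x) f x, wideProj j g x⟫_ℂ =
      ∫ u, ∫ x, ⟪wideKernel n j u • multOp (fun ξ => a x ξ - a (x - u) ξ) f (x - u), g x⟫_ℂ := by
  set κ := wideKernel n j with hκ
  set M := A * ∫ ξ, ‖𝓕 (f : EuclideanSpace ℝ (Fin n) → H) ξ‖ with hM
  have hbd : ∀ x y, ‖multOp (a x) f y‖ ≤ M := fun x y => norm_multOp_le (hA x) f y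
  have hP : Continuous fun p : EuclideanSpace ℝ (Fin n) × EuclideanSpace ℝ (Fin n) =>
      multOp (a p.1) f (p.1 - p.2) :=
    continuous_multOp ha ha' hA f continuous_fst (continuous_fst.sub continuous_snd)
  have hQ : Continuous fun p : EuclideanSpace ℝ (Fin n) × EuclideanSpace ℝ (Fin n) =>
      multOp (a (p.1 - p.2)) f (p.1 - p.2) :=
    continuous_multOp ha ha' hA f (continuous_fst.sub continuous_snd)
      (continuous_fst.sub continuous_snd)
  have hF : Continuous fun x => multOp (a x) f x :=
    continuous_multOp ha ha' hA f continuous_id continuous_id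
  have hκ2 : Continuous fun p : EuclideanSpace ℝ (Fin n) × EuclideanSpace ℝ (Fin n) => κ p.2 :=
    κ.continuous.comp continuous_snd
  have hg1 : Continuous fun p : EuclideanSpace ℝ (Fin n) × EuclideanSpace ℝ (Fin n) => g p.1 :=
    g.continuous.comp continuous_fst
  have hInt : ∀ Φ : EuclideanSpace ℝ (Fin n) × EuclideanSpace ℝ (Fin n) → H, Continuous Φ →
      (∀ p, ‖Φ p‖ ≤ M) → Integrable (fun p => ⟪κ p.2 • Φ p, g p.1⟫_ℂ)
        ((volume : Measure (EuclideanSpace ℝ (Fin n))).prod volume) := by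
    intro Φ hΦ hΦM
    refine ((g.integrable.norm.mul_prod κ.integrable.norm).const_mul M).mono'
      ((hκ2.smul hΦ).inner hg1).aestronglyMeasurable (Filter.Eventually.of_forall fun p => ?_)
    refine (norm_inner_le_norm _ _).trans ?_
    rw [norm_smul]
    calc ‖κ p.2‖ * ‖Φ p‖ * ‖g p.1‖ ≤ ‖κ p.2‖ * M * ‖g p.1‖ := by
          gcongr
          exact hΦM p
      _ = _ := by ring
  have h1 := hInt _ hP (fun p => hbd _ _)
  have h2 := hInt _ hQ (fun p => hbd _ _)
  have e1 : ∫ x, ⟪multOp (a x) f x, g x⟫_ℂ =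
      ∫ p, ⟪κ p.2 • multOp (a p.1) f (p.1 - p.2), g p.1⟫_ℂ ∂(volume.prod volume) := by
    rw [integral_prod _ h1]
    congr 1
    ext x
    dsimp only
    have hx : Integrable fun u => κ u • multOp (a x) f (x - u) := by
      refine (κ.integrable.norm.const_mul M).mono' ?_ (Filter.Eventually.of_forall fun u => ?_)
      · exact (κ.continuous.smul (continuous_multOp ha ha' hA f continuous_const
          (continuous_const.sub continuous_id))).aestronglyMeasurable
      · rw [norm_smul, mul_comm]
        gcongr
        exact hbd _ _
    rw [← inner_integral_left hx]
    congr 1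
    have := integral_wideKernel_smul_fourierInv j (integrable_symbol_apply (ha' x) (hA x) f) x
    refine Eq.trans ?_ this.symm
    have hψ : (fun ξ => wideCut j ξ • a x ξ (𝓕 (f : EuclideanSpace ℝ (Fin n) → H) ξ)) =
        fun ξ => a x ξ (𝓕 (f : EuclideanSpace ℝ (Fin n) → H) ξ) := by
      ext ξ
      rw [← smul_apply, haw]
    rw [hψ, multOp]
  have e2 : ∫ x, ⟪multOp (a x) f x, wideProj j g x⟫_ℂ =
      ∫ p, ⟪κ p.2 • multOp (a (p.1 - p.2)) f (p.1 - p.2), g p.1⟫_ℂ ∂(volume.prod volume) := by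
    have hgc : Continuous fun p : EuclideanSpace ℝ (Fin n) × EuclideanSpace ℝ (Fin n) =>
        g (p.1 + p.2) := g.continuous.comp (by fun_prop)
    have h3' : Integrable (fun p : EuclideanSpace ℝ (Fin n) × EuclideanSpace ℝ (Fin n) =>
        ‖κ p.2‖ * ‖g (p.1 + p.2)‖) (volume.prod volume) := by
      refine (integrable_prod_iff' (hκ2.norm.mul hgc.norm).aestronglyMeasurable).2 ⟨?_, ?_⟩
      · exact Filter.Eventually.of_forall fun u =>
          (g.integrable.comp_add_right u).norm.const_mul ‖κ u‖
      · simp only [Pi.mul_apply, norm_mul, norm_norm, integral_const_mul]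
        simp only [integral_add_right_eq_self (fun x => ‖g x‖)]
        exact κ.integrable.norm.mul_const _
    have h3 : Integrable (Function.uncurry fun x u => ⟪multOp (a x) f x,
        (starRingEnd ℂ) (κ u) • g (x + u)⟫_ℂ) (volume.prod volume) := by
      refine (h3'.const_mul M).mono' ?_ (Filter.Eventually.of_forall fun p => ?_)
      · exact ((hF.comp continuous_fst).inner
          ((Complex.continuous_conj.comp hκ2).smul hgc)).aestronglyMeasurable
      · refine (norm_inner_le_norm _ _).trans ?_
        rw [norm_smul, RCLike.norm_conj]
        gcongr
        exact hbd _ _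
    rw [integral_prod_symm _ h2]
    calc ∫ x, ⟪multOp (a x) f x, wideProj j g x⟫_ℂ
        = ∫ x, ∫ u, ⟪multOp (a x) f x, (starRingEnd ℂ) (κ u) • g (x + u)⟫_ℂ := by
          congr 1
          ext x
          rw [wideProj_apply, ← integral_inner]
          refine ((g.integrable.comp_add_left x).norm.const_mul
            (SchwartzMap.seminorm ℝ 0 0 κ)).mono' ?_ (Filter.Eventually.of_forall fun u => ?_)
          · exact ((Complex.continuous_conj.comp κ.continuous).smul
              (g.continuous.comp (by fun_prop))).aestronglyMeasurable
          · rw [norm_smul, RCLike.norm_conj]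
            gcongr
            exact SchwartzMap.norm_le_seminorm ℝ κ u
      _ = ∫ u, ∫ x, ⟪multOp (a x) f x, (starRingEnd ℂ) (κ u) • g (x + u)⟫_ℂ :=
          integral_integral_swap h3
      _ = _ := by
          congr 1
          ext u
          rw [← integral_sub_right_eq_self (fun x => ⟪multOp (a x) f x,
            (starRingEnd ℂ) (κ u) • g (x + u)⟫_ℂ) u]
          congr 1
          ext x
          rw [sub_add_cancel, inner_smul_right, inner_smul_left]
  rw [e1, e2, ← integral_sub' h1 h2, integral_prod_symm _ (h1.sub h2)]
  congr 1
  ext u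
  congr 1
  ext x
  rw [Pi.sub_apply, ← inner_sub_left, ← smul_sub,
    multOp_sub (ha' x) (ha' (x - u)) (hA x) (hA (x - u))]

end Pairing

section MainEstimate

variable {n : ℕ} {H : Type*} [NormedAddCommGroup H] [InnerProductSpace ℂ H] [CompleteSpace H]

/-- An operator-valued symbol satisfying zero-order estimates, with modulus of continuity `Ω` in
the space variable. -/
structure RoughSymbol (N : ℕ)
    (b : EuclideanSpace ℝ (Fin n) → EuclideanSpace ℝ (Fin n) → (H →L[ℂ] H)) (B : ℝ)
    (Ω : ℝ → ℝ) : Prop where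
  continuous_left : ∀ ξ, Continuous fun x => b x ξ
  bound : ∀ x, HasSymbolBound N (b x) B
  modulus : ∀ x x', HasSymbolBound N (fun ξ => b x ξ - b x' ξ) (B * Ω ‖x - x'‖)

variable {N : ℕ} {b : EuclideanSpace ℝ (Fin n) → EuclideanSpace ℝ (Fin n) → (H →L[ℂ] H)} {B : ℝ}
  {Ω : ℝ → ℝ}

theorem modulus_le (hmono : Monotone Ω) (h0 : ∀ t, 0 ≤ Ω t) (h2 : ∀ t, Ω t ≤ 2) (j : ℕ) {t : ℝ}
    (ht : 0 ≤ t) : Ω t ≤ Ω ((2 ^ j)⁻¹) + 2 * 2 ^ j * t := by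
  rcases le_total t ((2 ^ j)⁻¹) with h | h
  · have : 0 ≤ 2 * 2 ^ j * t := by positivity
    linarith [hmono h]
  · have h1 : 1 ≤ 2 ^ j * t := by
      rwa [inv_le_iff_one_le_mul₀' (by positivity)] at h
    linarith [h2 t, h0 ((2 ^ j)⁻¹)]

theorem RoughSymbol.norm_cutoff_le (hb : RoughSymbol N b B Ω) {θ : EuclideanSpace ℝ (Fin n) → ℝ}
    {c : ℝ} (hθ : ∀ ξ, |θ ξ| ≤ c) (x ξ : EuclideanSpace ℝ (Fin n)) :
    ‖θ ξ • b x ξ‖ ≤ c * B := by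
  rw [norm_smul]
  exact mul_le_mul (hθ ξ) ((hb.bound x).norm_le ξ) (norm_nonneg _)
    ((abs_nonneg _).trans (hθ 0))

theorem RoughSymbol.continuous_cutoff_left (hb : RoughSymbol N b B Ω)
    (θ : EuclideanSpace ℝ (Fin n) → ℝ) (ξ : EuclideanSpace ℝ (Fin n)) :
    Continuous fun x => θ ξ • b x ξ := by
  have := hb.continuous_left ξ
  fun_prop

theorem RoughSymbol.continuous_cutoff (hb : RoughSymbol N b B Ω)
    {θ : EuclideanSpace ℝ (Fin n) → ℝ} (hθ : Continuous θ) (x : EuclideanSpace ℝ (Fin n)) :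
    Continuous fun ξ => θ ξ • b x ξ :=
  hθ.smul (hb.bound x).contDiff.continuous

theorem abs_bandCut_le (j : ℕ) (ξ : EuclideanSpace ℝ (Fin n)) : |bandCut j ξ| ≤ 1 := by
  rw [bandCut, abs_le]
  constructor <;> linarith [lowCut_nonneg ((j : ℤ) + 1) ξ, lowCut_le_one ((j : ℤ) + 1) ξ,
    lowCut_nonneg (j : ℤ) ξ, lowCut_le_one (j : ℤ) ξ]

theorem abs_lowCut_le (j : ℤ) (ξ : EuclideanSpace ℝ (Fin n)) : |lowCut j ξ| ≤ 1 := by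
  rw [abs_of_nonneg (lowCut_nonneg j ξ)]
  exact lowCut_le_one j ξ

theorem integrable_inner_multOp
    {a : EuclideanSpace ℝ (Fin n) → EuclideanSpace ℝ (Fin n) → (H →L[ℂ] H)} {A : ℝ}
    (ha : ∀ ξ, Continuous fun x => a x ξ)
    (ha' : ∀ x, Continuous (a x)) (hA : ∀ x ξ, ‖a x ξ‖ ≤ A)
    (f g : 𝓢(EuclideanSpace ℝ (Fin n), H)) :
    Integrable fun x => ⟪multOp (a x) f x, g x⟫_ℂ := by
  refine (g.integrable.norm.const_mul
    (A * ∫ ξ, ‖𝓕 (f : EuclideanSpace ℝ (Fin n) → H) ξ‖)).mono'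
    ((continuous_multOp ha ha' hA f continuous_id continuous_id).inner
      g.continuous).aestronglyMeasurable (Filter.Eventually.of_forall fun x => ?_)
  refine (norm_inner_le_norm _ _).trans ?_
  gcongr
  exact norm_multOp_le (hA x) f x

variable (n H) in
/-- The `L²` bounds for the pieces of the dyadic decomposition. -/
theorem exists_piece_bounds (hN : n < 2 * N) :
    ∃ K : ℝ, 0 ≤ K ∧
      ∀ (b : EuclideanSpace ℝ (Fin n) → EuclideanSpace ℝ (Fin n) → (H →L[ℂ] H)) (B : ℝ),
      (∀ x, HasSymbolBound N (b x) B) → ∀ (f : 𝓢(EuclideanSpace ℝ (Fin n), H)),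
      (∫⁻ x, ‖multOp (fun ξ => lowCut 0 ξ • b x ξ) f x‖ₑ ^ 2 ≤
        ENNReal.ofReal (K * B * l2Norm f) ^ 2) ∧
      ∀ j u, ∫⁻ x, ‖multOp (fun ξ => bandCut j ξ • b x ξ) f (x - u)‖ₑ ^ 2 ≤
        ENNReal.ofReal (K * B * l2Norm (wideProj j f)) ^ 2 := by
  obtain ⟨K₀, hK₀, h₀⟩ := exists_localized_bound H hN (lowCut_contDiff (n := n) 0)
    (lowCut_hasCompactSupport 0)
  obtain ⟨K₁, hK₁, h₁⟩ := exists_localized_bound H hN (bandCut_contDiff (n := n) 0)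
    (bandCut_hasCompactSupport 0)
  refine ⟨K₀ + K₁, by positivity, fun b B hb f => ⟨?_, fun j u => ?_⟩⟩
  · have hB : 0 ≤ B := (norm_nonneg _).trans ((hb 0).norm_le 0)
    have hf := l2Norm_nonneg f
    have h := h₀ 1 one_pos (fun ξ _ => one_le_bracket _) b B hb f 0
    simp only [inv_one, one_smul, sub_zero] at h
    refine h.trans ?_
    rw [lintegral_enorm_sq_schwartz, ← mul_pow, ← ENNReal.ofReal_mul (by positivity)]
    refine pow_le_pow_left' (ENNReal.ofReal_le_ofReal ?_) 2
    gcongr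
    linarith
  · have hB : 0 ≤ B := (norm_nonneg _).trans ((hb 0).norm_le 0)
    have hf := l2Norm_nonneg (wideProj j f)
    have h4 : (0 : ℝ) < 4 ^ j := by positivity
    have h := h₁ (4 ^ j) h4 (fun ξ hξ => ?_) b B hb (wideProj j f) u
    · simp only [← bandCut_eq, multOp_bandCut_wideProj] at h
      refine h.trans ?_
      rw [lintegral_enorm_sq_schwartz, ← mul_pow, ← ENNReal.ofReal_mul (by positivity)]
      refine pow_le_pow_left' (ENNReal.ofReal_le_ofReal ?_) 2
      gcongr
      linarith
    · refine le_trans ?_ (norm_le_bracket _)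
      rw [norm_smul, Real.norm_of_nonneg h4.le]
      exact le_mul_of_one_le_right h4.le (one_le_norm_of_mem_tsupport_bandCut hξ)

theorem norm_integral_inner_band_le (hmono : Monotone Ω) (h0 : ∀ t, 0 ≤ Ω t)
    (h2 : ∀ t, Ω t ≤ 2) (hb : RoughSymbol N b B Ω) {K : ℝ} (hK0 : 0 ≤ K)
    (hK : ∀ (b : EuclideanSpace ℝ (Fin n) → EuclideanSpace ℝ (Fin n) → (H →L[ℂ] H)) (B : ℝ),
      (∀ x, HasSymbolBound N (b x) B) → ∀ (f : 𝓢(EuclideanSpace ℝ (Fin n), H)) (j : ℕ)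
      (u : EuclideanSpace ℝ (Fin n)),
      ∫⁻ x, ‖multOp (fun ξ => bandCut j ξ • b x ξ) f (x - u)‖ₑ ^ 2 ≤
        ENNReal.ofReal (K * B * l2Norm (wideProj j f)) ^ 2)
    (j : ℕ) (f g : 𝓢(EuclideanSpace ℝ (Fin n), H)) :
    ‖∫ x, ⟪multOp (fun ξ => bandCut j ξ • b x ξ) f x, g x⟫_ℂ‖ ≤
      K * B * (l2Norm (wideProj j f) * l2Norm (wideProj j g) +
        ((∫ u, ‖wideKernel n 0 u‖) * Ω ((2 ^ j)⁻¹) +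
          2 * (∫ u, ‖u‖ * ‖wideKernel n 0 u‖) * (2 ^ j)⁻¹) *
            l2Norm (wideProj j f) * l2Norm g) := by
  have hB : 0 ≤ B := (norm_nonneg _).trans ((hb.bound 0).norm_le 0)
  have hfj := l2Norm_nonneg (wideProj j f)
  have hgj := l2Norm_nonneg (wideProj j g)
  have hg := l2Norm_nonneg g
  set a : EuclideanSpace ℝ (Fin n) → EuclideanSpace ℝ (Fin n) → (H →L[ℂ] H) :=
    fun x ξ => bandCut j ξ • b x ξ with ha
  have hac : ∀ ξ, Continuous fun x => a x ξ := hb.continuous_cutoff_left _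
  have hac' : ∀ x, Continuous (a x) := hb.continuous_cutoff (bandCut_contDiff j).continuous
  have haA : ∀ x ξ, ‖a x ξ‖ ≤ B := fun x ξ => by
    simpa using hb.norm_cutoff_le (abs_bandCut_le j) x ξ
  have hFc : Continuous fun x => multOp (a x) f x :=
    continuous_multOp hac hac' haA f continuous_id continuous_id
  have hdiff := integral_inner_sub_wideProj j hac hac' haA
    (fun x ξ => by rw [ha, smul_smul, mul_comm, bandCut_mul_wideCut]) f g
  have hmain : ‖∫ x, ⟪multOp (a x) f x, wideProj j g x⟫_ℂ‖ ≤
      (K * B * l2Norm (wideProj j f)) * l2Norm (wideProj j g) := by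
    refine norm_integral_inner_le hFc.aestronglyMeasurable
      (wideProj j g).continuous.aestronglyMeasurable (by positivity) (l2Norm_nonneg _) ?_
      (lintegral_enorm_sq_schwartz _).le
    simpa using hK b B hb.bound f j 0
  have herr : ∀ u, ‖∫ x, ⟪wideKernel n j u •
      multOp (fun ξ => a x ξ - a (x - u) ξ) f (x - u), g x⟫_ℂ‖ ≤
      K * B * l2Norm (wideProj j f) * l2Norm g * (Ω ((2 ^ j)⁻¹) * ‖wideKernel n j u‖ +
        2 * 2 ^ j * (‖u‖ * ‖wideKernel n j u‖)) := by
    intro u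
    have hG : ∀ x ξ, a x ξ - a (x - u) ξ = bandCut j ξ • (b x ξ - b (x - u) ξ) :=
      fun x ξ => (smul_sub _ _ _).symm
    have hGc : Continuous fun x => multOp (fun ξ => a x ξ - a (x - u) ξ) f (x - u) :=
      continuous_multOp (a := fun x ξ => a x ξ - a (x - u) ξ) (A := B + B)
        (fun ξ => (hac ξ).sub ((hac ξ).comp (continuous_id.sub continuous_const)))
        (fun x => (hac' x).sub (hac' (x - u)))
        (fun x ξ => (norm_sub_le _ _).trans (add_le_add (haA _ _) (haA _ _))) f continuous_id
        (continuous_id.sub continuous_const)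
    have h1 : ‖∫ x, ⟪multOp (fun ξ => a x ξ - a (x - u) ξ) f (x - u), g x⟫_ℂ‖ ≤
        (K * (B * Ω ‖u‖) * l2Norm (wideProj j f)) * l2Norm g := by
      have := h0 ‖u‖
      refine norm_integral_inner_le hGc.aestronglyMeasurable g.continuous.aestronglyMeasurable
        (by positivity) (l2Norm_nonneg _) ?_ (lintegral_enorm_sq_schwartz _).le
      simp only [hG]
      refine hK (fun x ξ => b x ξ - b (x - u) ξ) (B * Ω ‖u‖) (fun x => ?_) f j u
      simpa using hb.modulus x (x - u)
    simp only [inner_smul_left]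
    rw [integral_const_mul, norm_mul, RCLike.norm_conj]
    calc _ ≤ ‖wideKernel n j u‖ * (K * (B * (Ω ((2 ^ j)⁻¹) + 2 * 2 ^ j * ‖u‖)) *
          l2Norm (wideProj j f) * l2Norm g) := by
          refine mul_le_mul_of_nonneg_left (h1.trans ?_) (norm_nonneg _)
          gcongr
          exact modulus_le hmono h0 h2 j (norm_nonneg u)
      _ = _ := by ring
  have hi1 : Integrable fun u => ‖wideKernel n j u‖ := (wideKernel n j).integrable.norm
  have hi2 : Integrable fun u => ‖u‖ * ‖wideKernel n j u‖ := by
    simpa using (wideKernel n j).integrable_pow_mul volume 1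
  have herr' := norm_integral_le_of_norm_le
    (((hi1.const_mul (Ω ((2 ^ j)⁻¹))).add (hi2.const_mul (2 * 2 ^ j))).const_mul
      (K * B * l2Norm (wideProj j f) * l2Norm g)) (Filter.Eventually.of_forall herr)
  rw [← hdiff] at herr'
  have hval : ∫ u, K * B * l2Norm (wideProj j f) * l2Norm g *
      (Ω ((2 ^ j)⁻¹) * ‖wideKernel n j u‖ + 2 * 2 ^ j * (‖u‖ * ‖wideKernel n j u‖)) =
      K * B * (((∫ u, ‖wideKernel n 0 u‖) * Ω ((2 ^ j)⁻¹) +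
          2 * (∫ u, ‖u‖ * ‖wideKernel n 0 u‖) * (2 ^ j)⁻¹) *
            l2Norm (wideProj j f) * l2Norm g) := by
    rw [integral_const_mul, integral_add (hi1.const_mul _) (hi2.const_mul _), integral_const_mul,
      integral_const_mul, integral_norm_wideKernel, integral_norm_mul_norm_wideKernel,
      show ((4 : ℝ) ^ j) = 2 ^ j * 2 ^ j by rw [← mul_pow]; norm_num]
    field_simp
  have herr'' := herr'.trans hval.le
  calc ‖∫ x, ⟪multOp (a x) f x, g x⟫_ℂ‖
      = ‖((∫ x, ⟪multOp (a x) f x, g x⟫_ℂ) - ∫ x, ⟪multOp (a x) f x, wideProj j g x⟫_ℂ) +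
          ∫ x, ⟪multOp (a x) f x, wideProj j g x⟫_ℂ‖ := by rw [sub_add_cancel]
    _ ≤ _ := (norm_add_le _ _).trans (add_le_add herr'' hmain)
    _ = _ := by ring

theorem sum_inv_two_pow_sq_le (J : ℕ) : ∑ j ∈ Finset.range J, ((2 : ℝ) ^ j)⁻¹ ^ 2 ≤ 2 := by
  have h : ∀ J : ℕ, ∑ j ∈ Finset.range J, ((2 : ℝ) ^ j)⁻¹ ≤ 2 - 2 * (2 ^ J)⁻¹ := by
    intro J
    induction J with
    | zero => simp
    | succ J ih =>
      rw [Finset.sum_range_succ, pow_succ, mul_inv]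
      linarith
  have h2 : 0 ≤ 2 * ((2 : ℝ) ^ J)⁻¹ := by positivity
  refine le_trans (Finset.sum_le_sum fun j _ => ?_) ((h J).trans (by linarith))
  have h3 : ((2 : ℝ) ^ j)⁻¹ ≤ 1 := inv_le_one_of_one_le₀ (one_le_pow₀ (by norm_num))
  have h4 : 0 ≤ ((2 : ℝ) ^ j)⁻¹ := by positivity
  nlinarith

theorem multOp_lowCut_succ (hb : RoughSymbol N b B Ω) (f : 𝓢(EuclideanSpace ℝ (Fin n), H))
    (J : ℕ) (x : EuclideanSpace ℝ (Fin n)) :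
    multOp (fun ξ => lowCut ((J + 1 : ℕ) : ℤ) ξ • b x ξ) f x =
      multOp (fun ξ => lowCut (J : ℤ) ξ • b x ξ) f x +
        multOp (fun ξ => bandCut J ξ • b x ξ) f x := by
  have h := multOp_sub (hb.continuous_cutoff (lowCut_contDiff ((J : ℤ) + 1)).continuous x)
    (hb.continuous_cutoff (lowCut_contDiff (J : ℤ)).continuous x)
    (hb.norm_cutoff_le (abs_lowCut_le _) x) (hb.norm_cutoff_le (abs_lowCut_le _) x) f x
  simp only [bandCut, sub_smul]
  rw [h]
  push_cast
  abel

theorem memLp_two_of_lintegral_le {F : EuclideanSpace ℝ (Fin n) → H} {r : ℝ} (hF : Continuous F)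
    (hr : ∫⁻ x, ‖F x‖ₑ ^ 2 ≤ ENNReal.ofReal r ^ 2) : MemLp F 2 := by
  refine ⟨hF.aestronglyMeasurable, ?_⟩
  have h : eLpNorm F 2 volume ^ 2 = ∫⁻ x, ‖F x‖ₑ ^ 2 := by
    simpa using eLpNorm_nnreal_pow_eq_lintegral (p := 2) (f := F)
      (μ := (volume : Measure (EuclideanSpace ℝ (Fin n)))) two_ne_zero
  have h' : eLpNorm F 2 volume ^ 2 < ⊤ :=
    lt_of_le_of_lt (h.trans_le hr) (ENNReal.pow_lt_top ENNReal.ofReal_lt_top)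
  exact (ENNReal.pow_lt_top_iff.1 h').resolve_right (by norm_num)

/-- The truncated operators are bounded on `L²` in the weak sense, uniformly in the truncation. -/
theorem exists_truncated_bound (hN : n < 2 * N) (hmono : Monotone Ω) (h0 : ∀ t, 0 ≤ Ω t)
    (h2 : ∀ t, Ω t ≤ 2) {D : ℝ} (hD : ∀ J, ∑ j ∈ Finset.range J, Ω ((2 ^ j)⁻¹) ^ 2 ≤ D)
    (hb : RoughSymbol N b B Ω) :
    ∃ C : ℝ, 0 ≤ C ∧ ∀ (J : ℕ) (f : 𝓢(EuclideanSpace ℝ (Fin n), H)),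
      MemLp (fun x => multOp (fun ξ => lowCut (J : ℤ) ξ • b x ξ) f x) 2 ∧
      ∀ g : 𝓢(EuclideanSpace ℝ (Fin n), H),
      ‖∫ x, ⟪multOp (fun ξ => lowCut (J : ℤ) ξ • b x ξ) f x, g x⟫_ℂ‖ ≤
        C * l2Norm f * l2Norm g := by
  have hB : 0 ≤ B := (norm_nonneg _).trans ((hb.bound 0).norm_le 0)
  obtain ⟨K, hK0, hK⟩ := exists_piece_bounds n H hN
  obtain ⟨c₀, hc₀⟩ : ∃ c, c = ∫ u, ‖wideKernel n 0 u‖ := ⟨_, rfl⟩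
  obtain ⟨c₁, hc₁⟩ : ∃ c, c = ∫ u, ‖u‖ * ‖wideKernel n 0 u‖ := ⟨_, rfl⟩
  obtain ⟨w, hw⟩ : ∃ w : ℕ → ℝ, ∀ j, w j = c₀ * Ω ((2 ^ j)⁻¹) + 2 * c₁ * (2 ^ j)⁻¹ :=
    ⟨_, fun _ => rfl⟩
  obtain ⟨W, hW⟩ : ∃ W, W = 2 * c₀ ^ 2 * D + 16 * c₁ ^ 2 := ⟨_, rfl⟩
  have hsum_w : ∀ J, ∑ j ∈ Finset.range J, w j ^ 2 ≤ W := by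
    intro J
    calc ∑ j ∈ Finset.range J, w j ^ 2
        ≤ ∑ j ∈ Finset.range J,
            (2 * c₀ ^ 2 * Ω ((2 ^ j)⁻¹) ^ 2 + 8 * c₁ ^ 2 * ((2 : ℝ) ^ j)⁻¹ ^ 2) := by
          refine Finset.sum_le_sum fun j _ => ?_
          rw [hw]
          nlinarith [sq_nonneg (c₀ * Ω ((2 ^ j)⁻¹) - 2 * c₁ * ((2 : ℝ) ^ j)⁻¹)]
      _ = 2 * c₀ ^ 2 * ∑ j ∈ Finset.range J, Ω ((2 ^ j)⁻¹) ^ 2 +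
            8 * c₁ ^ 2 * ∑ j ∈ Finset.range J, ((2 : ℝ) ^ j)⁻¹ ^ 2 := by
          rw [Finset.sum_add_distrib, Finset.mul_sum, Finset.mul_sum]
      _ ≤ 2 * c₀ ^ 2 * D + 8 * c₁ ^ 2 * 2 := by
          gcongr
          · exact hD J
          · exact sum_inv_two_pow_sq_le J
      _ = W := by rw [hW]; ring
  have hlow_c : ∀ f : 𝓢(EuclideanSpace ℝ (Fin n), H),
      Continuous fun x => multOp (fun ξ => lowCut 0 ξ • b x ξ) f x := fun f =>
    continuous_multOp (a := fun x ξ => lowCut 0 ξ • b x ξ) (hb.continuous_cutoff_left _)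
      (hb.continuous_cutoff (lowCut_contDiff 0).continuous)
      (hb.norm_cutoff_le (abs_lowCut_le 0)) f continuous_id continuous_id
  have hband_c : ∀ (f : 𝓢(EuclideanSpace ℝ (Fin n), H)) (j : ℕ),
      Continuous fun x => multOp (fun ξ => bandCut j ξ • b x ξ) f x := fun f j =>
    continuous_multOp (a := fun x ξ => bandCut j ξ • b x ξ) (hb.continuous_cutoff_left _)
      (hb.continuous_cutoff (bandCut_contDiff j).continuous)
      (hb.norm_cutoff_le (abs_bandCut_le j)) f continuous_id continuous_id
  refine ⟨K * B + K * B * (√3 * √3 + √W * √3), by positivity, fun J f => ⟨?_, fun g => ?_⟩⟩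
  · induction J with
    | zero => exact memLp_two_of_lintegral_le (hlow_c f) (hK b B hb.bound f).1
    | succ J ih =>
      simp only [multOp_lowCut_succ hb f J]
      have h := (hK b B hb.bound f).2 J 0
      simp only [sub_zero] at h
      exact ih.add (memLp_two_of_lintegral_le (hband_c f J) h)
  · have hf := l2Norm_nonneg f
    have hg := l2Norm_nonneg g
    have hexp : ∀ J : ℕ, ∫ x, ⟪multOp (fun ξ => lowCut (J : ℤ) ξ • b x ξ) f x, g x⟫_ℂ =
        (∫ x, ⟪multOp (fun ξ => lowCut 0 ξ • b x ξ) f x, g x⟫_ℂ) +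
          ∑ j ∈ Finset.range J, ∫ x, ⟪multOp (fun ξ => bandCut j ξ • b x ξ) f x, g x⟫_ℂ := by
      intro J
      induction J with
      | zero => simp
      | succ J ih =>
        rw [Finset.sum_range_succ, ← add_assoc, ← ih]
        simp only [multOp_lowCut_succ hb f J, inner_add_left]
        refine integral_add ?_ ?_
        · exact integrable_inner_multOp (a := fun x ξ => lowCut (J : ℤ) ξ • b x ξ)
            (hb.continuous_cutoff_left _)
            (hb.continuous_cutoff (lowCut_contDiff _).continuous)
            (hb.norm_cutoff_le (abs_lowCut_le _)) f g
        · exact integrable_inner_multOp (a := fun x ξ => bandCut J ξ • b x ξ)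
            (hb.continuous_cutoff_left _)
            (hb.continuous_cutoff (bandCut_contDiff _).continuous)
            (hb.norm_cutoff_le (abs_bandCut_le _)) f g
    have hlow : ‖∫ x, ⟪multOp (fun ξ => lowCut 0 ξ • b x ξ) f x, g x⟫_ℂ‖ ≤
        (K * B * l2Norm f) * l2Norm g :=
      norm_integral_inner_le (hlow_c f).aestronglyMeasurable g.continuous.aestronglyMeasurable
        (by positivity) (l2Norm_nonneg _) (hK b B hb.bound f).1 (lintegral_enorm_sq_schwartz g).le
    have hband : ∀ j, ‖∫ x, ⟪multOp (fun ξ => bandCut j ξ • b x ξ) f x, g x⟫_ℂ‖ ≤ K * B *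
        (l2Norm (wideProj j f) * l2Norm (wideProj j g) +
          w j * l2Norm (wideProj j f) * l2Norm g) := by
      intro j
      have h := norm_integral_inner_band_le hmono h0 h2 hb hK0
        (fun b B hb f j u => (hK b B hb f).2 j u) j f g
      rwa [← hc₀, ← hc₁, ← hw] at h
    have hsq : ∀ h : 𝓢(EuclideanSpace ℝ (Fin n), H),
        √(∑ j ∈ Finset.range J, l2Norm (wideProj j h) ^ 2) ≤ √3 * l2Norm h := fun h => by
      refine (Real.sqrt_le_sqrt (sum_norm_sq_wideProj_le J h)).trans ?_
      rw [Real.sqrt_mul (by norm_num), Real.sqrt_sq (l2Norm_nonneg _)]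
    have hs1 : ∑ j ∈ Finset.range J, l2Norm (wideProj j f) * l2Norm (wideProj j g) ≤
        (√3 * l2Norm f) * (√3 * l2Norm g) :=
      (Real.sum_mul_le_sqrt_mul_sqrt _ _ _).trans
        (mul_le_mul (hsq f) (hsq g) (Real.sqrt_nonneg _) (by positivity))
    have hs2 : ∑ j ∈ Finset.range J, w j * l2Norm (wideProj j f) ≤
        √W * (√3 * l2Norm f) :=
      (Real.sum_mul_le_sqrt_mul_sqrt _ _ _).trans
        (mul_le_mul (Real.sqrt_le_sqrt (hsum_w J)) (hsq f) (Real.sqrt_nonneg _) (by positivity))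
    rw [hexp J]
    calc _ ≤ K * B * l2Norm f * l2Norm g + ∑ j ∈ Finset.range J, K * B *
          (l2Norm (wideProj j f) * l2Norm (wideProj j g) +
            w j * l2Norm (wideProj j f) * l2Norm g) :=
          (norm_add_le _ _).trans (add_le_add hlow ((norm_sum_le _ _).trans
            (Finset.sum_le_sum fun j _ => hband j)))
      _ = K * B * l2Norm f * l2Norm g + K * B *
          (∑ j ∈ Finset.range J, l2Norm (wideProj j f) * l2Norm (wideProj j g) +
            (∑ j ∈ Finset.range J, w j * l2Norm (wideProj j f)) * l2Norm g) := by
          rw [← Finset.mul_sum, Finset.sum_add_distrib, Finset.sum_mul]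
      _ ≤ K * B * l2Norm f * l2Norm g + K * B *
          ((√3 * l2Norm f) * (√3 * l2Norm g) +
            (√W * (√3 * l2Norm f)) * l2Norm g) := by gcongr
      _ = _ := by ring

end MainEstimate

end

section

open scoped FourierTransform ENNReal InnerProductSpace

section Extension

variable {n : ℕ} {H : Type*} [NormedAddCommGroup H] [InnerProductSpace ℂ H] [CompleteSpace H]

theorem eLpNorm_le_of_pairing {F : EuclideanSpace ℝ (Fin n) → H} (hF : MemLp F 2) {M : ℝ} (hM : 0 ≤ M)
    (h : ∀ g : 𝓢(EuclideanSpace ℝ (Fin n), H), ‖∫ x, ⟪F x, g x⟫_ℂ‖ ≤ M * l2Norm g) :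
    eLpNorm F 2 volume ≤ ENNReal.ofReal M := by
  have key : ∀ G : Lp H 2 (volume : Measure (EuclideanSpace ℝ (Fin n))),
      ‖⟪hF.toLp F, G⟫_ℂ‖ ≤ M * ‖G‖ := by
    intro G
    refine DenseRange.induction_on (SchwartzMap.denseRange_toLpCLM (F := H) (p := 2)
      (μ := (volume : Measure (EuclideanSpace ℝ (Fin n)))) ENNReal.ofNat_ne_top) G
      (isClosed_le (by fun_prop) (by fun_prop)) fun g => ?_
    rw [SchwartzMap.toLpCLM_apply, L2.inner_def]
    have e : ∫ x, ⟪(hF.toLp F : EuclideanSpace ℝ (Fin n) → H) x,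
        (g.toLp 2 volume : EuclideanSpace ℝ (Fin n) → H) x⟫_ℂ = ∫ x, ⟪F x, g x⟫_ℂ := by
      refine integral_congr_ae ?_
      filter_upwards [hF.coeFn_toLp, g.coeFn_toLp 2 volume] with x h1 h2
      rw [h1, h2]
    rw [e]
    exact h g
  have h1 := key (hF.toLp F)
  rw [inner_self_eq_norm_sq_to_K] at h1
  have h2 : ‖hF.toLp F‖ ^ 2 ≤ M * ‖hF.toLp F‖ := by simpa using h1
  have h3 : ‖hF.toLp F‖ ≤ M := by
    rcases (norm_nonneg (hF.toLp F)).eq_or_lt' with h0 | h0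
    · rwa [h0]
    · nlinarith
  rw [← Lp.enorm_toLp hF, ← ofReal_norm]
  exact ENNReal.ofReal_le_ofReal h3

variable {N : ℕ} {b : EuclideanSpace ℝ (Fin n) → EuclideanSpace ℝ (Fin n) → (H →L[ℂ] H)} {B : ℝ}
  {Ω : ℝ → ℝ}

theorem tendsto_multOp_lowCut (hb : RoughSymbol N b B Ω) (f : 𝓢(EuclideanSpace ℝ (Fin n), H))
    (x : EuclideanSpace ℝ (Fin n)) :
    Filter.Tendsto (fun J : ℕ => multOp (fun ξ => lowCut (J : ℤ) ξ • b x ξ) f x) Filter.atTop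
      (nhds (multOp (b x) f x)) := by
  simp only [multOp_apply]
  refine tendsto_integral_of_dominated_convergence
    (fun ξ => 1 * B * ‖𝓕 (f : EuclideanSpace ℝ (Fin n) → H) ξ‖) (fun J => ?_)
    ((integrable_fourier_schwartz f).norm.const_mul _)
    (fun J => Filter.Eventually.of_forall fun ξ => ?_)
    (Filter.Eventually.of_forall fun ξ => ?_)
  · have h1 : Continuous fun ξ : EuclideanSpace ℝ (Fin n) =>
        Real.fourierChar (inner ℝ ξ x) := Real.continuous_fourierChar.comp (by fun_prop)
    exact (h1.smul ((hb.continuous_cutoff (lowCut_contDiff (J : ℤ)).continuous x).clm_apply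
      (continuous_fourier_of_integrable f.integrable))).aestronglyMeasurable
  · rw [Circle.norm_smul]
    exact norm_symbol_apply_le (hb.norm_cutoff_le (abs_lowCut_le _) x) f ξ
  · have h := (tendsto_lowCut ξ).smul_const
      (Real.fourierChar (inner ℝ ξ x) • b x ξ (𝓕 (f : EuclideanSpace ℝ (Fin n) → H) ξ))
    rw [one_smul] at h
    refine h.congr fun J => ?_
    rw [smul_apply, smul_comm]

theorem exists_eLpNorm_multOp_le (hN : n < 2 * N) (hmono : Monotone Ω) (h0 : ∀ t, 0 ≤ Ω t)
    (h2 : ∀ t, Ω t ≤ 2) {D : ℝ} (hD : ∀ J, ∑ j ∈ Finset.range J, Ω ((2 ^ j)⁻¹) ^ 2 ≤ D)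
    (hb : RoughSymbol N b B Ω) :
    ∃ C : ℝ, 0 ≤ C ∧ ∀ f : 𝓢(EuclideanSpace ℝ (Fin n), H),
      MemLp (fun x => multOp (b x) f x) 2 ∧
      eLpNorm (fun x => multOp (b x) f x) 2 volume ≤ ENNReal.ofReal (C * l2Norm f) := by
  obtain ⟨C, hC0, hC⟩ := exists_truncated_bound hN hmono h0 h2 hD hb
  refine ⟨C, hC0, fun f => ?_⟩
  have hle : eLpNorm (fun x => multOp (b x) f x) 2 volume ≤ ENNReal.ofReal (C * l2Norm f) := by
    refine (Lp.eLpNorm_lim_le_liminf_eLpNorm (fun J => (hC J f).1.aestronglyMeasurable) _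
      (Filter.Eventually.of_forall fun x => tendsto_multOp_lowCut hb f x)).trans ?_
    refine Filter.liminf_le_of_le (by isBoundedDefault) fun c hc => ?_
    obtain ⟨J, hJ⟩ := hc.exists
    exact hJ.trans (eLpNorm_le_of_pairing (hC J f).1 (mul_nonneg hC0 (l2Norm_nonneg f))
      (hC J f).2)
  have hcont : Continuous fun x => multOp (b x) f x :=
    continuous_multOp hb.continuous_left (fun x => (hb.bound x).contDiff.continuous)
      (fun x => (hb.bound x).norm_le) f continuous_id continuous_id
  exact ⟨⟨hcont.aestronglyMeasurable, hle.trans_lt ENNReal.ofReal_lt_top⟩, hle⟩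

theorem integrable_multOp_integrand {b : EuclideanSpace ℝ (Fin n) → (H →L[ℂ] H)} {A : ℝ}
    (hb : Continuous b) (hA : ∀ ξ, ‖b ξ‖ ≤ A) (f : 𝓢(EuclideanSpace ℝ (Fin n), H))
    (x : EuclideanSpace ℝ (Fin n)) :
    Integrable fun ξ => Real.fourierChar (inner ℝ ξ x) •
      b ξ (𝓕 (f : EuclideanSpace ℝ (Fin n) → H) ξ) := by
  simpa using (Real.fourierIntegral_convergent_iff (-x)).2 (integrable_symbol_apply hb hA f)

theorem multOp_add_right {b : EuclideanSpace ℝ (Fin n) → (H →L[ℂ] H)} {A : ℝ}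
    (hb : Continuous b) (hA : ∀ ξ, ‖b ξ‖ ≤ A) (f g : 𝓢(EuclideanSpace ℝ (Fin n), H))
    (x : EuclideanSpace ℝ (Fin n)) :
    multOp b (f + g : 𝓢(EuclideanSpace ℝ (Fin n), H)) x = multOp b f x + multOp b g x := by
  simp only [multOp_apply]
  rw [← integral_add (integrable_multOp_integrand hb hA f x)
    (integrable_multOp_integrand hb hA g x)]
  congr 1
  ext ξ
  simp only [← SchwartzMap.fourier_coe, FourierTransform.fourier_add, add_apply,
    map_add, smul_add]

theorem multOp_smul_right (b : EuclideanSpace ℝ (Fin n) → (H →L[ℂ] H)) (c : ℂ)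
    (f : 𝓢(EuclideanSpace ℝ (Fin n), H)) (x : EuclideanSpace ℝ (Fin n)) :
    multOp b (c • f : 𝓢(EuclideanSpace ℝ (Fin n), H)) x = c • multOp b f x := by
  simp only [multOp_apply]
  rw [← integral_smul]
  congr 1
  ext ξ
  simp only [← SchwartzMap.fourier_coe, FourierTransform.fourier_smul, smul_apply,
    map_smul]
  rw [smul_comm]

theorem exists_bounded_extension (hN : n < 2 * N) (hmono : Monotone Ω) (h0 : ∀ t, 0 ≤ Ω t)
    (h2 : ∀ t, Ω t ≤ 2) {D : ℝ} (hD : ∀ J, ∑ j ∈ Finset.range J, Ω ((2 ^ j)⁻¹) ^ 2 ≤ D)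
    (hb : RoughSymbol N b B Ω) :
    ∃ T : Lp H 2 (volume : Measure (EuclideanSpace ℝ (Fin n))) →L[ℂ]
        Lp H 2 (volume : Measure (EuclideanSpace ℝ (Fin n))),
      ∀ f : 𝓢(EuclideanSpace ℝ (Fin n), H),
        T (f.toLp 2) =ᵐ[volume] fun x => multOp (b x) f x := by
  obtain ⟨C, hC0, hC⟩ := exists_eLpNorm_multOp_le hN hmono h0 h2 hD hb
  have hbc : ∀ x, Continuous (b x) := fun x => (hb.bound x).contDiff.continuous
  let L : 𝓢(EuclideanSpace ℝ (Fin n), H) →ₗ[ℂ]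
      Lp H 2 (volume : Measure (EuclideanSpace ℝ (Fin n))) :=
    { toFun := fun f => (hC f).1.toLp _
      map_add' := fun f g => by
        rw [← MemLp.toLp_add]
        exact MemLp.toLp_congr _ _ (Filter.Eventually.of_forall fun x =>
          multOp_add_right (hbc x) (hb.bound x).norm_le f g x)
      map_smul' := fun c f => by
        rw [RingHom.id_apply, ← MemLp.toLp_const_smul]
        exact MemLp.toLp_congr _ _ (Filter.Eventually.of_forall fun x =>
          multOp_smul_right (b x) c f x) }
  have hL : ∀ f, L f = (hC f).1.toLp _ := fun f => rfl
  let e : 𝓢(EuclideanSpace ℝ (Fin n), H) →ₗ[ℂ]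
      Lp H 2 (volume : Measure (EuclideanSpace ℝ (Fin n))) :=
    (SchwartzMap.toLpCLM ℂ H 2 volume).toLinearMap
  have hdense : DenseRange e := SchwartzMap.denseRange_toLpCLM (F := H) (p := 2)
      (μ := (volume : Measure (EuclideanSpace ℝ (Fin n)))) ENNReal.ofNat_ne_top
  have hnorm : ∃ C, ∀ f, ‖L f‖ ≤ C * ‖e f‖ := by
    refine ⟨C, fun f => ?_⟩
    rw [hL, Lp.norm_toLp]
    exact ENNReal.toReal_le_of_le_ofReal (mul_nonneg hC0 (norm_nonneg _)) (hC f).2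
  refine ⟨L.extendOfNorm e, fun f => ?_⟩
  have h : L.extendOfNorm e (f.toLp 2 volume) = L f := LinearMap.extendOfNorm_eq hdense hnorm f
  rw [h, hL]
  exact (hC f).1.coeFn_toLp

end Extension

section Dini

theorem sq_le_integral_dini {ω : ℝ → ℝ} (h0 : ∀ t, 0 ≤ t → 0 ≤ ω t)
    (hmono : MonotoneOn ω (Set.Ici 0)) {r : ℝ} (hr : 0 < r)
    (hi : IntervalIntegrable (fun t => ω t ^ 2 / t) volume r (2 * r)) :
    ω r ^ 2 ≤ 2 * ∫ t in r..(2 * r), ω t ^ 2 / t := by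
  have h := intervalIntegral.integral_mono_on (f := fun _ => ω r ^ 2 / (2 * r))
    (g := fun t => ω t ^ 2 / t) (a := r) (b := 2 * r) (by linarith) (by simp) hi fun t ht => by
      have h1 := h0 r hr.le
      have h2 : ω r ≤ ω t := hmono hr.le (hr.le.trans ht.1) ht.1
      have h3 : 0 < t := hr.trans_le ht.1
      have h4 := ht.2
      gcongr
  rw [intervalIntegral.integral_const, smul_eq_mul] at h
  have e : (2 * r - r) * (ω r ^ 2 / (2 * r)) = ω r ^ 2 / 2 := by field_simp; ring
  linarith

theorem sum_sq_le_integral_dini {ω : ℝ → ℝ} (h0 : ∀ t, 0 ≤ t → 0 ≤ ω t)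
    (hmono : MonotoneOn ω (Set.Ici 0))
    (hi : IntegrableOn (fun t => ω t ^ 2 / t) (Set.Ioc 0 1)) (J : ℕ) :
    ∑ j ∈ Finset.range J, ω ((2 ^ (j + 1))⁻¹) ^ 2 ≤
      2 * ∫ t in Set.Ioc 0 1, ω t ^ 2 / t := by
  have hInt : ∀ r s : ℝ, 0 ≤ r → r ≤ 1 → 0 ≤ s → s ≤ 1 →
      IntervalIntegrable (fun t => ω t ^ 2 / t) volume r s := by
    intro r s hr hr' hs hs'
    have h01 : IntervalIntegrable (fun t => ω t ^ 2 / t) volume 0 1 :=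
      (intervalIntegrable_iff_integrableOn_Ioc_of_le zero_le_one).2 hi
    refine h01.mono_set ?_
    rw [Set.uIcc_of_le (zero_le_one (α := ℝ))]
    exact Set.uIcc_subset_Icc ⟨hr, hr'⟩ ⟨hs, hs'⟩
  have hpow : ∀ J : ℕ, 0 ≤ ((2 : ℝ) ^ J)⁻¹ ∧ ((2 : ℝ) ^ J)⁻¹ ≤ 1 := fun J =>
    ⟨by positivity, inv_le_one_of_one_le₀ (one_le_pow₀ (by norm_num))⟩
  have key : ∀ J : ℕ, ∑ j ∈ Finset.range J, ω ((2 ^ (j + 1))⁻¹) ^ 2 ≤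
      2 * ∫ t in ((2 : ℝ) ^ J)⁻¹..1, ω t ^ 2 / t := by
    intro J
    induction J with
    | zero => simp
    | succ J ih =>
      have e : 2 * ((2 : ℝ) ^ (J + 1))⁻¹ = (2 ^ J)⁻¹ := by
        rw [pow_succ]
        field_simp
      have h1 := sq_le_integral_dini h0 hmono (r := ((2 : ℝ) ^ (J + 1))⁻¹) (by positivity) (by
        rw [e]
        exact hInt _ _ (hpow _).1 (hpow _).2 (hpow _).1 (hpow _).2)
      rw [e] at h1
      rw [Finset.sum_range_succ, ← intervalIntegral.integral_add_adjacent_intervals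
        (hInt _ _ (hpow (J + 1)).1 (hpow (J + 1)).2 (hpow J).1 (hpow J).2)
        (hInt _ _ (hpow J).1 (hpow J).2 zero_le_one le_rfl)]
      linarith
  refine (key J).trans ?_
  rw [← intervalIntegral.integral_of_le zero_le_one,
    ← intervalIntegral.integral_add_adjacent_intervals
      (hInt _ _ le_rfl zero_le_one (hpow J).1 (hpow J).2)
      (hInt _ _ (hpow J).1 (hpow J).2 zero_le_one le_rfl)]
  have : 0 ≤ ∫ t in (0 : ℝ)..((2 : ℝ) ^ J)⁻¹, ω t ^ 2 / t :=
    intervalIntegral.integral_nonneg (hpow J).1 fun t ht => div_nonneg (sq_nonneg _) ht.1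
  linarith

/-- A bounded monotone truncation of a modulus of continuity. -/
noncomputable def truncModulus (ω : ℝ → ℝ) (t : ℝ) : ℝ := min (ω (max t 0)) 2

theorem truncModulus_monotone {ω : ℝ → ℝ} (hmono : MonotoneOn ω (Set.Ici 0)) :
    Monotone (truncModulus ω) := fun s t hst =>
  min_le_min_right _ (hmono (le_max_right s 0) (le_max_right t 0) (max_le_max_right 0 hst))

theorem truncModulus_nonneg {ω : ℝ → ℝ} (h0 : ∀ t, 0 ≤ t → 0 ≤ ω t) (t : ℝ) :
    0 ≤ truncModulus ω t := le_min (h0 _ (le_max_right _ _)) zero_le_two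

theorem truncModulus_le_two (ω : ℝ → ℝ) (t : ℝ) : truncModulus ω t ≤ 2 := min_le_right _ _

theorem truncModulus_le {ω : ℝ → ℝ} {t : ℝ} (ht : 0 ≤ t) : truncModulus ω t ≤ ω t := by
  rw [truncModulus, max_eq_left ht]
  exact min_le_left _ _

theorem sum_truncModulus_sq_le {ω : ℝ → ℝ} (h0 : ∀ t, 0 ≤ t → 0 ≤ ω t)
    (hmono : MonotoneOn ω (Set.Ici 0))
    (hi : IntegrableOn (fun t => ω t ^ 2 / t) (Set.Ioc 0 1)) (J : ℕ) :
    ∑ j ∈ Finset.range J, truncModulus ω ((2 ^ j)⁻¹) ^ 2 ≤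
      4 + 2 * ∫ t in Set.Ioc 0 1, ω t ^ 2 / t := by
  have h1 : ∑ j ∈ Finset.range J, truncModulus ω ((2 ^ j)⁻¹) ^ 2 ≤
      ∑ j ∈ Finset.range (J + 1), truncModulus ω ((2 ^ j)⁻¹) ^ 2 :=
    Finset.sum_le_sum_of_subset_of_nonneg (Finset.range_mono (by omega))
      fun _ _ _ => sq_nonneg _
  rw [Finset.sum_range_succ'] at h1
  have h2 : ∑ j ∈ Finset.range J, truncModulus ω ((2 ^ (j + 1))⁻¹) ^ 2 ≤
      ∑ j ∈ Finset.range J, ω ((2 ^ (j + 1))⁻¹) ^ 2 :=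
    Finset.sum_le_sum fun j _ =>
      pow_le_pow_left₀ (truncModulus_nonneg h0 _) (truncModulus_le (by positivity)) 2
  have h3 := sum_sq_le_integral_dini h0 hmono hi J
  have h4 : truncModulus ω ((2 ^ 0)⁻¹) ^ 2 ≤ 4 := by
    have a := truncModulus_le_two ω ((2 ^ 0)⁻¹)
    have b := truncModulus_nonneg h0 ((2 ^ 0)⁻¹)
    nlinarith
  linarith

theorem exists_modulus_lt {Ω : ℝ → ℝ} {D : ℝ}
    (hD : ∀ J, ∑ j ∈ Finset.range J, Ω ((2 ^ j)⁻¹) ^ 2 ≤ D) {ε : ℝ} (hε : 0 < ε) :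
    ∃ j : ℕ, Ω ((2 ^ j)⁻¹) < ε := by
  have hs : Summable fun j : ℕ => Ω ((2 ^ j)⁻¹) ^ 2 :=
    summable_of_sum_range_le (fun _ => sq_nonneg _) hD
  obtain ⟨j, hj⟩ := (hs.tendsto_atTop_zero.eventually (gt_mem_nhds (pow_pos hε 2))).exists
  exact ⟨j, lt_of_pow_lt_pow_left₀ 2 hε.le hj⟩

end Dini

section ChangeOfVariables

variable {n : ℕ}

theorem bracket_le_bracket_smul {c : ℝ} (hc : 1 ≤ c) (ξ : EuclideanSpace ℝ (Fin n)) :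
    bracket ξ ≤ bracket (c • ξ) := by
  have h : ‖ξ‖ ≤ ‖c • ξ‖ := by
    rw [norm_smul, Real.norm_of_nonneg (zero_le_one.trans hc)]
    exact le_mul_of_one_le_left (norm_nonneg _) hc
  rw [bracket, bracket]
  gcongr

theorem HasSymbolBound.comp_smul {F : Type*} [NormedAddCommGroup F] [NormedSpace ℝ F] {N : ℕ}
    {b : EuclideanSpace ℝ (Fin n) → F} {B c : ℝ} (hb : HasSymbolBound N b B) (hc : 1 ≤ c) :
    HasSymbolBound N (fun η => b (c • η)) (c ^ N * B) := by
  have hB : 0 ≤ B := (norm_nonneg _).trans (hb.norm_le 0)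
  have hc0 : 0 ≤ c := zero_le_one.trans hc
  refine ⟨hb.contDiff.comp (contDiff_const_smul c), fun ξ => ?_, fun i k hk ξ => ?_⟩
  · exact (hb.norm_le _).trans (le_mul_of_one_le_left hB (one_le_pow₀ hc))
  · rw [iterate_partialD_comp_smul (hb.contDiff.of_le (by exact_mod_cast hk)), norm_smul,
      Real.norm_of_nonneg (pow_nonneg hc0 k), mul_assoc]
    have h1 : 0 < bracket ξ := zero_lt_one.trans_le (one_le_bracket ξ)
    have h2 := bracket_le_bracket_smul hc ξ
    have h3 := hb.norm_partialD_le i k hk (c • ξ)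
    have h4 : 0 ≤ B * (bracket (c • ξ) ^ k)⁻¹ := (norm_nonneg _).trans h3
    calc c ^ k * ‖(partialD i)^[k] b (c • ξ)‖
        ≤ c ^ k * (B * (bracket (c • ξ) ^ k)⁻¹) := by gcongr
      _ ≤ c ^ N * (B * (bracket ξ ^ k)⁻¹) := by gcongr

variable {H : Type*} [NormedAddCommGroup H] [InnerProductSpace ℂ H]

theorem angularFourier_two_pi_smul (f : EuclideanSpace ℝ (Fin n) → H)
    (η : EuclideanSpace ℝ (Fin n)) : angularFourier f ((2 * Real.pi) • η) = 𝓕 f η := by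
  rw [angularFourier, Real.fourier_eq']
  congr 1 with y
  rw [real_inner_smul_right]
  congr 2
  push_cast
  ring

theorem pseudoDiff_eq_multOp
    (σ : EuclideanSpace ℝ (Fin n) → EuclideanSpace ℝ (Fin n) → (H →L[ℂ] H))
    (f : EuclideanSpace ℝ (Fin n) → H) (x : EuclideanSpace ℝ (Fin n)) :
    pseudoDiff σ f x = multOp (fun η => σ x ((2 * Real.pi) • η)) f x := by
  have h := MeasureTheory.Measure.integral_comp_smul (volume : Measure (EuclideanSpace ℝ (Fin n)))
    (fun ξ => Complex.exp (Complex.I * (inner ℝ x ξ : ℝ)) • σ x ξ (angularFourier f ξ))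
    (2 * Real.pi)
  rw [finrank_euclideanSpace_fin, abs_of_pos (by positivity)] at h
  rw [pseudoDiff, ← h, multOp, Real.fourierInv_eq']
  congr 1 with η
  rw [angularFourier_two_pi_smul, real_inner_smul_right, real_inner_comm]
  congr 2
  push_cast
  ring

end ChangeOfVariables

section SymbolBounds

variable {n : ℕ} {F : Type*} [NormedAddCommGroup F] [NormedSpace ℝ F]

/-- The sum of the constants belonging to the pure derivatives up to order `N`. -/
noncomputable def pureConst (N : ℕ) (C : (Fin n → ℕ) → ℝ) : ℝ :=
  |C 0| + ∑ i, ∑ k ∈ Finset.range (N + 1), |C (Pi.single i k)|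

theorem le_pureConst_zero (N : ℕ) (C : (Fin n → ℕ) → ℝ) : |C 0| ≤ pureConst N C :=
  le_add_of_nonneg_right (Finset.sum_nonneg fun _ _ => Finset.sum_nonneg fun _ _ => abs_nonneg _)

theorem le_pureConst_single {N : ℕ} (C : (Fin n → ℕ) → ℝ) (i : Fin n) {k : ℕ} (hk : k ≤ N) :
    |C (Pi.single i k)| ≤ pureConst N C := by
  have h1 : |C (Pi.single i k)| ≤ ∑ k ∈ Finset.range (N + 1), |C (Pi.single i k)| :=
    Finset.single_le_sum (f := fun k => |C (Pi.single i k)|) (fun _ _ => abs_nonneg _)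
      (Finset.mem_range.2 (by omega))
  have h2 : ∑ k ∈ Finset.range (N + 1), |C (Pi.single i k)| ≤
      ∑ i, ∑ k ∈ Finset.range (N + 1), |C (Pi.single i k)| :=
    Finset.single_le_sum (f := fun i => ∑ k ∈ Finset.range (N + 1), |C (Pi.single i k)|)
      (fun _ _ => Finset.sum_nonneg fun _ _ => abs_nonneg _) (Finset.mem_univ i)
  have h3 := abs_nonneg (C 0)
  rw [pureConst]
  linarith

theorem hasSymbolBound_of_multiD {N : ℕ} {b : EuclideanSpace ℝ (Fin n) → F}
    (hb : ContDiff ℝ N b) {C : (Fin n → ℕ) → ℝ}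
    (h : ∀ α : Fin n → ℕ, multiLength α ≤ N → ∀ ξ,
      ‖multiD α b ξ‖ ≤ C α * bracket ξ ^ (-(multiLength α : ℤ))) :
    HasSymbolBound N b (pureConst N C) := by
  refine ⟨hb, fun ξ => ?_, fun i k hk ξ => ?_⟩
  · have h0 := h 0 (by simp [multiLength]) ξ
    rw [multiD_zero] at h0
    simp only [multiLength, Pi.zero_apply, Finset.sum_const_zero, Nat.cast_zero, neg_zero,
      zpow_zero, mul_one] at h0
    exact h0.trans ((le_abs_self _).trans (le_pureConst_zero N C))
  · have h0 := h (Pi.single i k) (by rwa [multiLength_single]) ξ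
    rw [multiD_single, multiLength_single, zpow_neg, zpow_natCast] at h0
    have h1 : 0 < bracket ξ := zero_lt_one.trans_le (one_le_bracket ξ)
    have h2 := (le_abs_self _).trans (le_pureConst_single C i hk)
    exact h0.trans (by gcongr)

theorem hasSymbolBound_sub_of_multiD {N : ℕ} {b b' : EuclideanSpace ℝ (Fin n) → F}
    (hb : ContDiff ℝ N b) (hb' : ContDiff ℝ N b') {C : (Fin n → ℕ) → ℝ} {r : ℝ} (hr : 0 ≤ r)
    (h : ∀ α : Fin n → ℕ, multiLength α ≤ N → ∀ ξ,
      ‖multiD α b ξ‖ ≤ C α * bracket ξ ^ (-(multiLength α : ℤ)))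
    (h' : ∀ α : Fin n → ℕ, multiLength α ≤ N → ∀ ξ,
      ‖multiD α b' ξ‖ ≤ C α * bracket ξ ^ (-(multiLength α : ℤ)))
    (hd : ∀ α : Fin n → ℕ, multiLength α ≤ N → ∀ ξ,
      ‖multiD α b ξ - multiD α b' ξ‖ ≤ C α * bracket ξ ^ (-(multiLength α : ℤ)) * r) :
    HasSymbolBound N (fun ξ => b ξ - b' ξ) (pureConst N C * min r 2) := by
  have hmin : ∀ α : Fin n → ℕ, multiLength α ≤ N → ∀ ξ,
      ‖multiD α b ξ - multiD α b' ξ‖ ≤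
        C α * bracket ξ ^ (-(multiLength α : ℤ)) * min r 2 := by
    intro α hα ξ
    rcases min_cases r 2 with ⟨e, -⟩ | ⟨e, -⟩ <;> rw [e]
    · exact hd α hα ξ
    · have := norm_sub_le (multiD α b ξ) (multiD α b' ξ)
      linarith [h α hα ξ, h' α hα ξ]
  have hm : 0 ≤ min r 2 := le_min hr zero_le_two
  refine ⟨hb.sub hb', fun ξ => ?_, fun i k hk ξ => ?_⟩
  · have h0 := hmin 0 (by simp [multiLength]) ξ
    rw [multiD_zero, multiD_zero] at h0
    simp only [multiLength, Pi.zero_apply, Finset.sum_const_zero, Nat.cast_zero, neg_zero,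
      zpow_zero, mul_one] at h0
    have h2 := (le_abs_self _).trans (le_pureConst_zero N C)
    exact h0.trans (by gcongr)
  · have h0 := hmin (Pi.single i k) (by rwa [multiLength_single]) ξ
    rw [multiD_single, multiD_single, multiLength_single, zpow_neg, zpow_natCast] at h0
    have hk' : (k : WithTop ℕ∞) ≤ N := by exact_mod_cast hk
    rw [iterate_partialD_sub (hb.of_le hk') (hb'.of_le hk'), mul_right_comm]
    have h1 : 0 < bracket ξ := zero_lt_one.trans_le (one_le_bracket ξ)
    have h2 := (le_abs_self _).trans (le_pureConst_single C i hk)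
    exact h0.trans (by gcongr)

end SymbolBounds

section RoughSymbol

variable {n : ℕ} {H : Type*} [NormedAddCommGroup H] [InnerProductSpace ℂ H]

theorem continuous_of_modulus {E F : Type*} [NormedAddCommGroup E] [NormedAddCommGroup F]
    {g : E → F} {B D : ℝ} (hB : 0 ≤ B) {Ω : ℝ → ℝ} (hmono : Monotone Ω)
    (hD : ∀ J, ∑ j ∈ Finset.range J, Ω ((2 ^ j)⁻¹) ^ 2 ≤ D)
    (hg : ∀ x x', ‖g x - g x'‖ ≤ B * Ω ‖x - x'‖) : Continuous g := by
  rw [Metric.continuous_iff]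
  intro x' ε hε
  obtain ⟨j, hj⟩ := exists_modulus_lt hD (ε := ε / (B + 1)) (by positivity)
  refine ⟨(2 ^ j)⁻¹, by positivity, fun x hx => ?_⟩
  rw [dist_eq_norm] at hx ⊢
  calc ‖g x - g x'‖ ≤ B * Ω ‖x - x'‖ := hg x x'
    _ ≤ B * (ε / (B + 1)) := mul_le_mul_of_nonneg_left ((hmono hx.le).trans hj.le) hB
    _ < (B + 1) * (ε / (B + 1)) := by
      have : 0 < ε / (B + 1) := by positivity
      nlinarith
    _ = ε := by field_simp

theorem roughSymbol_comp_smul {N : ℕ}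
    {σ : EuclideanSpace ℝ (Fin n) → EuclideanSpace ℝ (Fin n) → (H →L[ℂ] H)} {B D c : ℝ}
    (hc : 1 ≤ c) {Ω : ℝ → ℝ} (hmono : Monotone Ω)
    (hD : ∀ J, ∑ j ∈ Finset.range J, Ω ((2 ^ j)⁻¹) ^ 2 ≤ D)
    (hσ : ∀ x, HasSymbolBound N (σ x) B)
    (hσ' : ∀ x x', HasSymbolBound N (fun ξ => σ x ξ - σ x' ξ) (B * Ω ‖x - x'‖)) :
    RoughSymbol N (fun x η => σ x (c • η)) (c ^ N * B) Ω where
  continuous_left η := continuous_of_modulus ((norm_nonneg _).trans ((hσ 0).norm_le 0)) hmono hD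
    fun x x' => (hσ' x x').norm_le (c • η)
  bound x := (hσ x).comp_smul hc
  modulus x x' := by
    rw [mul_assoc]
    exact (hσ' x x').comp_smul hc

end RoughSymbol

end

theorem theorem4p1 {n : ℕ} {H : Type*} [NormedAddCommGroup H] [InnerProductSpace ℂ H]
    [CompleteSpace H]
    (σ : EuclideanSpace ℝ (Fin n) → EuclideanSpace ℝ (Fin n) → (H →L[ℂ] H))
    (ω : ℝ → ℝ) (C : (Fin n → ℕ) → ℝ)
    (hω_nonneg : ∀ t, 0 ≤ t → 0 ≤ ω t)
    (hω_mono : MonotoneOn ω (Set.Ici 0))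
    (hω_dini : IntegrableOn (fun t => ω t ^ 2 / t) (Set.Ioc 0 1))
    (hσ_diff : ∀ x, TimesDifferentiable (n / 2 + 2) (σ x))
    (hσ_bound : ∀ α : Fin n → ℕ, multiLength α ≤ n / 2 + 2 → ∀ x ξ,
      ‖multiD α (σ x) ξ‖ ≤ C α * bracket ξ ^ (-(multiLength α : ℤ)))
    (hσ_mod : ∀ α : Fin n → ℕ, multiLength α ≤ n / 2 + 2 → ∀ x x' ξ,
      ‖multiD α (σ x) ξ - multiD α (σ x') ξ‖ ≤
        C α * bracket ξ ^ (-(multiLength α : ℤ)) * ω ‖x - x'‖) :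
    ∃ T : Lp H 2 (volume : Measure (EuclideanSpace ℝ (Fin n))) →L[ℂ]
        Lp H 2 (volume : Measure (EuclideanSpace ℝ (Fin n))),
      ∀ f : 𝓢(EuclideanSpace ℝ (Fin n), H), T (f.toLp 2) =ᵐ[volume] pseudoDiff σ f := by
  have hcd : ∀ x, ContDiff ℝ (n / 2 + 1 : ℕ) (σ x) := fun x => (hσ_diff x).contDiff
  have hbd : ∀ x, ∀ α : Fin n → ℕ, multiLength α ≤ n / 2 + 1 → ∀ ξ,
      ‖multiD α (σ x) ξ‖ ≤ C α * bracket ξ ^ (-(multiLength α : ℤ)) :=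
    fun x α hα ξ => hσ_bound α (by omega) x ξ
  have hsum := sum_truncModulus_sq_le hω_nonneg hω_mono hω_dini
  have hmono := truncModulus_monotone hω_mono
  have hrough := roughSymbol_comp_smul (σ := σ) (c := 2 * Real.pi)
    (by linarith [Real.two_le_pi]) hmono hsum
    (fun x => hasSymbolBound_of_multiD (hcd x) (hbd x)) fun x x' => by
      rw [truncModulus, max_eq_left (norm_nonneg _)]
      exact hasSymbolBound_sub_of_multiD (hcd x) (hcd x') (hω_nonneg _ (norm_nonneg _))
        (hbd x) (hbd x') fun α hα ξ => hσ_mod α (by omega) x x' ξ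
  obtain ⟨T, hT⟩ := exists_bounded_extension (by omega) hmono (truncModulus_nonneg hω_nonneg)
    (truncModulus_le_two ω) hsum hrough
  refine ⟨T, fun f => (hT f).trans (Filter.Eventually.of_forall fun x => ?_)⟩
  exact (pseudoDiff_eq_multOp σ f x).symm
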